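/- **Theorem (Partial converse to the burn identity).** *Distribution.* Users' values are drawn i.i.d. from a distribution $D$ on $\mathbb R$ with finite mean and cdf $F$, which below the supremum of its support has a density $f$ (an atom at the supremum is allowed). Its virtual value function is $\varphi(v)=v-\frac{1-F(v)}{f(v)}$, with $\varphi(v)=-\infty$ where $F(v)<1$ and $f(v)=0$, and $\varphi(v)=v$ where $F(v)=1$. Assume that $D$ is smooth and regular: $\varphi$ is non-decreasing, continuous on the support of $D$, and $\Pr_{v\sim D}[\varphi(v)\le 0]>0$. Let $T$ be the set of all $v$ in the support of $D$ with $\varphi(v)>-\infty$; values and bids are elements of $T$. For $\vec v\in T^n$ write $\varphi(\vec v)=(\varphi(v_1),\dots,\varphi(v_n))$. *Mechanism.* A block-building process $(X,P,B)$ without miner advice assigns, measurably and anonymously (relabelling the bids relabels the outcome), to each number $n\in\mathbb N$ of bids and each $\vec b\in T^n$ allocation probabilities $X_i(\vec b)\in[0,1]$, payments $P_i(\vec b)\in\mathbb R$ $(1\le i\le n)$ and a burn $B(\vec b)\in\mathbb R$; it may depend on $D$. Suppose that there are functions $U^n:\mathbb R^n\to\mathbb R$, $n\in\mathbb N$, such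 that for all $n$ and $\vec v\in T^n$ $$X(\vec v)=\nabla U^n(\varphi(\vec v)),\qquad B(\vec v)=\sum_{i=1}^n\varphi(v_i)\,\nabla_iU^n(\varphi(\vec v))-U^n(\varphi(\vec v)),$$ $$P_i(\vec v)=v_i\,\nabla_iU^n(\varphi(\vec v))-\int_0^{v_i}\nabla_iU^n(\varphi(y),\varphi(\vec v_{-i}))\,dy .$$ Here $\nabla U^n(y)$ is the gradient of $U^n$ at $y$, or, where $U^n$ is not differentiable, a subgradient chosen as a function of $y$; the integrand is read as $0$ for $y\notin T$. Suppose further that for all $n$: 1. $U^n$ is convex and non-decreasing in every coordinate; 2. $\nabla_iU^n(\varphi(\vec v))=0$ whenever $\vec v\in T^n$ and $\varphi(v_i)<0$; 3. $U^n(\varphi(\vec v))=U^{n+t}(\varphi(\vec v),\varphi(\hat v))$ for all $t\in\mathbb N$, $\vec v\in T^n$ and $\hat v\in T^t$ with $\varphi(\hat v_j)\le 0$ for all $j$. Then the truthful outcome, in which all users bid their values and the miner forwards exactly these bids, is * *on-chain user simple*: for all $n$, $\vec v\in T^n$, users $i$ and bids $b\in T$, $\;v_iX_i(\vec v)-P_i(\vec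 v)\ge v_iX_i(b,\vec v_{-i})-P_i(b,\vec v_{-i})$; and * *off-chain influence proof*: for every number $n$ of users it is a Bayes–Nash equilibrium of the users under the trivial off-chain mechanism, and its expected net revenue to the miner is at least that of every user Bayes–Nash equilibrium of every off-chain mechanism. An *off-chain mechanism* collects messages from the users and, possibly at random, decides which on-chain bid each user submits (possibly none), which bids the miner fabricates, and off-chain transfers from the users to the miner. A user's payoff is his value times his allocation minus his on-chain and off-chain payments, and the miner's net revenue is the sum of the users' on-chain and off-chain payments minus the burn. In the *trivial* off-chain mechanism the users' messages are their bids, exactly these bids are submitted and there are no transfers. In a *Bayes–Nash equilibrium* all expectations involved exist, every user with every value in $T$ best-responds in expectation over the other users' values and the randomness of the mechanism, and his expected payoff is at least $0$, the payoff of staying out. -/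

import Mathlib

open MeasureTheory ProbabilityTheory Set

noncomputable section

namespace TFM

universe u

/-! ### Value distributions -/

/-- The virtual value `φ(v) = v - (1 - F(v)) / f(v)` of the value `v` for a distribution `D` with cdf
`F` and density `f`. It is `-∞` where the density vanishes although `F(v) < 1`. At the top of the
support (where `F(v) = 1`, possibly with an atom) the formula gives `φ(v) = v`. -/
def virtualValue (D : Measure ℝ) (f : ℝ → ℝ) (v : ℝ) : EReal :=
  open scoped Classical in
  if cdf D v < 1 ∧ f v = 0 then ⊥ else ((v - (1 - cdf D v) / f v : ℝ) : EReal)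

/-- `D` is a smooth regular distribution with density `f`: below the supremum of the support (which
is the set `{v | F(v) < 1}`) `D` has density `f`, the supremum itself may carry an atom, the virtual
value function is non-decreasing, it is continuous on the support, and a random draw has a
non-positive virtual value with positive probability. -/
structure IsSmoothRegular (D : Measure ℝ) (f : ℝ → ℝ) : Prop where
  measurable_density : Measurable f
  density_nonneg : ∀ v, 0 ≤ f v
  density : D.restrict {v | cdf D v < 1} =
    (volume.withDensity fun v => ENNReal.ofReal (f v)).restrict {v | cdf D v < 1}
  regular : Monotone (virtualValue D f)
  continuous : ContinuousOn (virtualValue D f) D.support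
  nonpos_pos : 0 < D {v | virtualValue D f v ≤ 0}

/-- The values (and bids): the points of the support of `D` with a finite virtual value. They have
full probability; the only point of the support that can be left out is its infimum. -/
def valueSpace (D : Measure ℝ) (f : ℝ → ℝ) : Set ℝ :=
  {v | v ∈ D.support ∧ virtualValue D f v ≠ ⊥}

/-- The virtual value as a real number, meaningful on `valueSpace D f`. -/
def vv (D : Measure ℝ) (f : ℝ → ℝ) (v : ℝ) : ℝ := (virtualValue D f v).toReal

/-- The distribution `D` as a measure on its space of values. -/
def valueLaw (D : Measure ℝ) (f : ℝ → ℝ) : Measure (valueSpace D f) :=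
  D.comap Subtype.val

/-! ### Block-building processes and the on-chain game -/

/-- An anonymous block-building process without miner advice, for bids in `T`. For every number `n`
of bids it determines the allocation probability and the payment of each bid, and the burn. -/
structure BlockBuildingProcess (T : Set ℝ) where
  alloc : (n : ℕ) → (Fin n → T) → Fin n → ℝ
  pay : (n : ℕ) → (Fin n → T) → Fin n → ℝ
  burn : (n : ℕ) → (Fin n → T) → ℝ
  alloc_mem : ∀ n b i, alloc n b i ∈ Icc (0 : ℝ) 1
  measurable_alloc : ∀ n i, Measurable fun b => alloc n b i
  measurable_pay : ∀ n i, Measurable fun b => pay n b i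
  measurable_burn : ∀ n, Measurable (burn n)
  alloc_anonymous : ∀ n (π : Equiv.Perm (Fin n)) b i, alloc n (b ∘ π) i = alloc n b (π i)
  pay_anonymous : ∀ n (π : Equiv.Perm (Fin n)) b i, pay n (b ∘ π) i = pay n b (π i)
  burn_anonymous : ∀ n (π : Equiv.Perm (Fin n)) b, burn n (b ∘ π) = burn n b

variable {T : Set ℝ}

/-- On-chain user simplicity of the equilibrium in which users bid their values and the miner
forwards all bids and nothing else: bidding one's value is a best response to any bids of the other
users. -/
def OnChainUserSimple (B : BlockBuildingProcess T) : Prop :=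
  ∀ (n : ℕ) (v : Fin n → T) (i : Fin n) (b : T),
    (v i : ℝ) * B.alloc n (Function.update v i b) i - B.pay n (Function.update v i b) i ≤
      (v i : ℝ) * B.alloc n v i - B.pay n v i

/-- What is finally submitted to the block-building process when there are `n` users: a list of
bids, and for every user the bid that is his own (`none` if the user is censored or submits no
bid). Bids that belong to no user are fabricated by the miner. -/
structure OnChainAction (T : Set ℝ) (n : ℕ) where
  numBids : ℕ
  bid : Fin numBids → T
  slot : Fin n → Option (Fin numBids)
  slot_injective : ∀ i i' j, slot i = some j → slot i' = some j → i = i'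

namespace OnChainAction

variable {n : ℕ}

/-- The allocation of user `i`. -/
def userAlloc (a : OnChainAction T n) (B : BlockBuildingProcess T) (i : Fin n) : ℝ :=
  (a.slot i).elim 0 (B.alloc a.numBids a.bid)

/-- The on-chain payment of user `i`. -/
def userPay (a : OnChainAction T n) (B : BlockBuildingProcess T) (i : Fin n) : ℝ :=
  (a.slot i).elim 0 (B.pay a.numBids a.bid)

/-- The burn. -/
def burn (a : OnChainAction T n) (B : BlockBuildingProcess T) : ℝ :=
  B.burn a.numBids a.bid

end OnChainAction

/-! ### The off-chain game -/

/-- An off-chain mechanism for `n` users. It collects messages and, possibly with the help of a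
random seed, decides on the bids of the users, on censored and fabricated bids, and on off-chain
transfers from the users to the miner. -/
structure OffChainMechanism (T : Set ℝ) (n : ℕ) : Type (u + 1) where
  Msg : Fin n → Type u
  Seed : Type u
  [seedSpace : MeasurableSpace Seed]
  seedLaw : Measure Seed
  [seedProb : IsProbabilityMeasure seedLaw]
  action : (∀ i, Msg i) → Seed → OnChainAction T n
  transfer : (∀ i, Msg i) → Seed → Fin n → ℝ

attribute [instance] OffChainMechanism.seedSpace OffChainMechanism.seedProb

namespace OffChainMechanism

variable {n : ℕ} (M : OffChainMechanism.{u} T n) (B : BlockBuildingProcess T) (μ : Measure T)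

/-- The allocation of user `i` for the messages `m` and the seed `ω`. -/
def userAlloc (m : ∀ i, M.Msg i) (ω : M.Seed) (i : Fin n) : ℝ :=
  (M.action m ω).userAlloc B i

/-- The total (on-chain and off-chain) payment of user `i`. -/
def userPay (m : ∀ i, M.Msg i) (ω : M.Seed) (i : Fin n) : ℝ :=
  (M.action m ω).userPay B i + M.transfer m ω i

/-- The net revenue of the miner: all payments of the users (what she pays for her fabricated bids
comes back to her) minus the burn. -/
def netRevenue (m : ∀ i, M.Msg i) (ω : M.Seed) : ℝ :=
  ∑ i, M.userPay B m ω i - (M.action m ω).burn B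

/-- The joint law of the users' values, drawn independently from `μ`, and of the seed. -/
def law : Measure ((Fin n → T) × M.Seed) :=
  (Measure.pi fun _ : Fin n => μ).prod M.seedLaw

variable (s : ∀ i, T → M.Msg i)

/-- The messages of all users if user `i` sends `m` and all others follow their strategy. -/
def deviate (i : Fin n) (m : M.Msg i) (v : Fin n → T) : ∀ j, M.Msg j :=
  Function.update (fun j => s j (v j)) i m

/-- The expected utility of user `i` with value `x` from sending the message `m`. -/
def interimUtility (i : Fin n) (x : T) (m : M.Msg i) : ℝ :=
  ∫ z, ((x : ℝ) * M.userAlloc B (M.deviate s i m z.1) z.2 i -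
    M.userPay B (M.deviate s i m z.1) z.2 i) ∂(M.law μ)

/-- The strategies `s` form a Bayes-Nash equilibrium of the users with respect to the off-chain
mechanism `M`: the expectations in question exist, no message is better than the prescribed one, and
no user prefers to stay out of the mechanism. -/
structure IsUserBNE : Prop where
  integrable_alloc_deviate : ∀ i (m : M.Msg i),
    Integrable (fun z => M.userAlloc B (M.deviate s i m z.1) z.2 i) (M.law μ)
  integrable_pay_deviate : ∀ i (m : M.Msg i),
    Integrable (fun z => M.userPay B (M.deviate s i m z.1) z.2 i) (M.law μ)
  integrable_alloc : ∀ i,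
    Integrable (fun z => M.userAlloc B (fun j => s j (z.1 j)) z.2 i) (M.law μ)
  integrable_pay : ∀ i,
    Integrable (fun z => M.userPay B (fun j => s j (z.1 j)) z.2 i) (M.law μ)
  integrable_burn :
    Integrable (fun z => (M.action (fun j => s j (z.1 j)) z.2).burn B) (M.law μ)
  best_response : ∀ i (x : T) (m : M.Msg i),
    M.interimUtility B μ s i x m ≤ M.interimUtility B μ s i x (s i x)
  participation : ∀ i (x : T), 0 ≤ M.interimUtility B μ s i x (s i x)

/-- The expected net revenue of the miner. -/
def expectedRevenue : ℝ :=
  ∫ z, M.netRevenue B (fun j => s j (z.1 j)) z.2 ∂(M.law μ)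

/-- The trivial off-chain mechanism: every user's message is his bid, exactly the users' bids are
submitted, and there are no off-chain transfers. -/
def trivial (T : Set ℝ) (n : ℕ) : OffChainMechanism.{0} T n where
  Msg _ := T
  Seed := Unit
  seedLaw := Measure.dirac ()
  action m _ := ⟨n, m, some, by simp_all⟩
  transfer _ _ _ := 0

end OffChainMechanism

/-- Off-chain influence proofness of the equilibrium in which users bid their values and the miner
forwards all bids and nothing else: it is an equilibrium, and for every number `n` of users no
off-chain mechanism and no user equilibrium of it give the miner a larger expected net revenue. -/
def OffChainInfluenceProof (B : BlockBuildingProcess T) (μ : Measure T) : Prop :=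
  ∀ n : ℕ,
    (OffChainMechanism.trivial T n).IsUserBNE B μ (fun _ x => x) ∧
    ∀ (M : OffChainMechanism.{u} T n) (s : ∀ i, T → M.Msg i), M.IsUserBNE B μ s →
      M.expectedRevenue B μ s ≤
        (OffChainMechanism.trivial T n).expectedRevenue B μ (fun _ x => x)

/-! ### Subgradients -/

/-- `g` is a subgradient of `U` at `y`. For convex `U` that is differentiable at `y` this says that
`g` is the gradient of `U` at `y`. -/
def IsSubgradient {n : ℕ} (U : (Fin n → ℝ) → ℝ) (y g : Fin n → ℝ) : Prop :=
  ∀ z, U y + ∑ i, g i * (z i - y i) ≤ U z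

end TFM

end

/-!
The proof compares every off-chain mechanism with the truthful outcome through one number, the
expected virtual utility `E[U n (φ(v))]`.

*Upper bound.* In a user equilibrium, best responses make the interim allocation `X` of a user
monotone and a subgradient of his interim utility `u`. As `u ≥ 0`, the envelope inequality
`rent_le_of_subgradient` gives `u(v) ≥ ∫ X(y) dy` over the values `y < v`. By Tonelli
(`lintegral_rent`) the expectation of the right-hand side is `E[X(v) (v - φ(v))]`, so the expected
payment is at most `E[φ(v) X(v)]` (`integral_pay_le_virtual`). This needs no a priori integrability
of `φ(v) X(v)`: the nonnegative gap `(v - φ(v)) X(v)` is dominated in expectation by `u`.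

The miner's revenue is thus at most the expected virtual surplus minus the burn. The burn is the
convex conjugate of `U` at the allocation, so the subgradient inequality at the submitted bids bounds
virtual surplus minus burn by `U` at the profile that carries the users' true virtual values in their
own slots and the virtual value of a reserve value elsewhere. That profile can be reached from the
truthful one by deleting users, adding nonpositive virtual values and reordering, none of which
increases `U` (`virtualSurplus_le`).

*Attainment.* Under truthful bidding a user keeps exactly his information rent, which makes truthful
bidding optimal for a monotone allocation (`rent_deviation`), and the same Tonelli identity turns the
payments into virtual surplus (`integral_pay_eq_virtual`). Virtual surplus minus burn is then `U` at
the true virtual values, by the definition of the burn.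

Structural facts about the distribution come first: a gap of the support would have virtual value
`-∞`, so the value space is an interval (`ordConnected_valueSpace`) of full measure, and by
continuity some value has virtual value exactly zero unless all are negative (`exists_reserve`).
-/

namespace TFM

/-! ### The value space and the virtual value -/

section ValueSpace

variable {D : Measure ℝ} {f : ℝ → ℝ}

theorem vv_eq {v : ℝ} (hv : v ∈ valueSpace D f) : vv D f v = v - (1 - cdf D v) / f v := by
  have h : ¬ (cdf D v < 1 ∧ f v = 0) := fun h => hv.2 (by simp [virtualValue, h])
  rw [vv, virtualValue, if_neg h, EReal.toReal_coe]

theorem coe_vv {v : ℝ} (hv : v ∈ valueSpace D f) : (vv D f v : EReal) = virtualValue D f v := by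
  have h : ¬ (cdf D v < 1 ∧ f v = 0) := fun h => hv.2 (by simp [virtualValue, h])
  rw [vv, virtualValue, if_neg h, EReal.toReal_coe]

theorem density_ne_zero {v : ℝ} (hv : v ∈ valueSpace D f) (hF : cdf D v < 1) : f v ≠ 0 :=
  fun h => hv.2 (by simp [virtualValue, hF, h])

theorem vv_le (hD : IsSmoothRegular D f) {v : ℝ} (hv : v ∈ valueSpace D f) : vv D f v ≤ v := by
  rw [vv_eq hv]
  have := div_nonneg (sub_nonneg.2 (cdf_le_one (μ := D) v)) (hD.density_nonneg v)
  linarith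

theorem monotoneOn_vv (hD : IsSmoothRegular D f) : MonotoneOn (vv D f) (valueSpace D f) := by
  intro v hv w hw hvw
  rw [← EReal.coe_le_coe_iff, coe_vv hv, coe_vv hw]
  exact hD.regular hvw

theorem measurableSet_cdf_lt_one : MeasurableSet {v | cdf D v < 1} :=
  measurableSet_lt (monotone_cdf (μ := D)).measurable measurable_const

/-- A gap in the support would have density zero, so the virtual value would be `-∞` there and, by
monotonicity, everywhere below. Hence the value space is an interval. -/
theorem ordConnected_valueSpace [IsProbabilityMeasure D] (hD : IsSmoothRegular D f) :
    (valueSpace D f).OrdConnected := by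
  refine ⟨fun v hv w hw y hy => ?_⟩
  have hbot : ∀ z, v ≤ z → virtualValue D f z ≠ ⊥ := fun z hz h =>
    hv.2 (le_bot_iff.1 (h ▸ hD.regular hz))
  refine ⟨?_, hbot y hy.1⟩
  by_contra hsupp
  have hvy : v < y := lt_of_le_of_ne hy.1 fun h => hsupp (h ▸ hv.1)
  have hyw : y < w := lt_of_le_of_ne hy.2 fun h => hsupp (h ▸ hw.1)
  obtain ⟨V, hV, hV0⟩ := Measure.notMem_support_iff_exists.1 hsupp
  have hFy : cdf D y < 1 := by
    have hpos : 0 < D (Ioi y) := (Measure.mem_support_iff_forall w).1 hw.1 _ (Ioi_mem_nhds hyw)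
    rw [cdf_eq_real, ← compl_Ioi, probReal_compl_eq_one_sub measurableSet_Ioi]
    have : 0 < D.real (Ioi y) := ENNReal.toReal_pos hpos.ne' (measure_ne_top _ _)
    linarith
  -- the part of the gap below `y` and above `v` has measure zero, hence density zero almost everywhere
  obtain ⟨a, ha, haV⟩ := (mem_nhdsLE_iff_exists_Ioc_subset' hvy).1 (mem_nhdsWithin_of_mem_nhds hV)
  set c := max a v
  have hcy : c < y := max_lt ha hvy
  have hsub : Ioc c y ⊆ {v | cdf D v < 1} := fun z hz =>
    (monotone_cdf (μ := D) hz.2).trans_lt hFy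
  have h0 : D (Ioc c y) = 0 :=
    measure_mono_null ((Ioc_subset_Ioc_left (le_max_left _ _)).trans haV) hV0
  have h1 : D (Ioc c y) = ∫⁻ z in Ioc c y, ENNReal.ofReal (f z) := by
    rw [← withDensity_apply _ measurableSet_Ioc, ← Measure.restrict_eq_self D hsub, hD.density,
      Measure.restrict_eq_self _ hsub]
  rw [h0, eq_comm, setLIntegral_eq_zero_iff measurableSet_Ioc hD.measurable_density.ennreal_ofReal]
    at h1
  have h2 : ∀ᵐ z : ℝ, z ∉ Ioc c y := by
    filter_upwards [h1] with z hz hz'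
    refine hbot z ((le_max_right _ _).trans hz'.1.le) ?_
    have : f z = 0 := le_antisymm (ENNReal.ofReal_eq_zero.1 (hz hz')) (hD.density_nonneg z)
    simp [virtualValue, this, show cdf D z < 1 from hsub hz']
  have h3 : volume (Ioc c y) = 0 := measure_eq_zero_iff_ae_notMem.2 h2
  simp only [Real.volume_Ioc, ENNReal.ofReal_eq_zero] at h3
  linarith

theorem measurableSet_valueSpace [IsProbabilityMeasure D] (hD : IsSmoothRegular D f) :
    MeasurableSet (valueSpace D f) :=
  (ordConnected_valueSpace hD).measurableSet

theorem measure_compl_valueSpace [IsProbabilityMeasure D] (hD : IsSmoothRegular D f) :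
    D (valueSpace D f)ᶜ = 0 := by
  have hf : MeasurableSet {v | f v = 0} := hD.measurable_density (measurableSet_singleton 0)
  have h0 : D ({v | f v = 0} ∩ {v | cdf D v < 1}) = 0 := by
    rw [← Measure.restrict_apply' measurableSet_cdf_lt_one, hD.density]
    refine le_antisymm ((Measure.restrict_apply_le _ _).trans ?_) (zero_le)
    rw [withDensity_apply _ hf, setLIntegral_congr_fun (g := 0) hf]
    · simp
    · intro z (hz : f z = 0)
      simp [hz]
  refine measure_mono_null ?_ (measure_union_null (Measure.measure_compl_support (μ := D)) h0)
  intro v hv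
  by_contra h
  simp only [mem_union, not_or, mem_inter_iff, not_and, mem_compl_iff, not_not, mem_ofPred_eq] at h
  exact hv ⟨h.1, fun hb => by
    by_cases hc : cdf D v < 1 ∧ f v = 0
    · exact h.2 hc.2 hc.1
    · rw [virtualValue, if_neg hc] at hb
      exact EReal.coe_ne_bot _ hb⟩

theorem isProbabilityMeasure_valueLaw [IsProbabilityMeasure D] (hD : IsSmoothRegular D f) :
    IsProbabilityMeasure (valueLaw D f) := by
  constructor
  rw [valueLaw, comap_subtype_coe_apply (measurableSet_valueSpace hD)]
  rw [image_univ, Subtype.range_coe]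
  exact (prob_compl_eq_zero_iff (measurableSet_valueSpace hD)).1 (measure_compl_valueSpace hD)

theorem map_valueLaw [IsProbabilityMeasure D] (hD : IsSmoothRegular D f) :
    (valueLaw D f).map Subtype.val = D := by
  rw [valueLaw, map_comap_subtype_coe (measurableSet_valueSpace hD)]
  exact Measure.restrict_eq_self_of_ae_mem (measure_compl_valueSpace hD)

theorem integrable_val_valueLaw [IsProbabilityMeasure D] (hD : IsSmoothRegular D f)
    (hmean : Integrable (fun v : ℝ => v) D) :
    Integrable (fun v : valueSpace D f => (v : ℝ)) (valueLaw D f) := by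
  rw [← map_valueLaw hD] at hmean
  exact hmean.comp_measurable measurable_subtype_coe

theorem measurable_vv [IsProbabilityMeasure D] (hD : IsSmoothRegular D f) :
    Measurable fun v : valueSpace D f => vv D f v := by
  have h : (fun v : valueSpace D f => vv D f v) =
      (fun v : ℝ => v - (1 - cdf D v) / f v) ∘ Subtype.val := by
    ext v
    exact vv_eq v.2
  rw [h]
  exact (measurable_id.sub ((measurable_const.sub (monotone_cdf (μ := D)).measurable).div
    hD.measurable_density)).comp measurable_subtype_coe

theorem continuousOn_vv (hD : IsSmoothRegular D f) : ContinuousOn (vv D f) (valueSpace D f) := by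
  intro v hv
  refine (EReal.tendsto_toReal ?_ hv.2).comp ((hD.continuous v hv.1).mono fun x hx => hx.1)
  rw [← coe_vv hv]
  exact EReal.coe_ne_top _

theorem exists_vv_nonpos [IsProbabilityMeasure D] (hD : IsSmoothRegular D f) :
    ∃ w : valueSpace D f, vv D f w ≤ 0 := by
  by_contra! h
  refine hD.nonpos_pos.ne' (measure_mono_null (fun v hv => ?_) (measure_compl_valueSpace hD))
  intro hvT
  have := h ⟨v, hvT⟩
  rw [← EReal.coe_lt_coe_iff, coe_vv hvT] at this
  exact absurd hv (not_le.2 this)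

/-- There is a reserve value: one with virtual value zero, unless all virtual values are
negative. -/
theorem exists_reserve [IsProbabilityMeasure D] (hD : IsSmoothRegular D f) :
    ∃ w : valueSpace D f, vv D f w ≤ 0 ∧
      (vv D f w = 0 ∨ ∀ v : valueSpace D f, vv D f v < 0) := by
  obtain ⟨w, hw⟩ := exists_vv_nonpos hD
  by_cases h : ∀ v : valueSpace D f, vv D f v < 0
  · exact ⟨w, hw, Or.inr h⟩
  · push Not at h
    obtain ⟨v, hv⟩ := h
    obtain ⟨z, hz, hz0⟩ := (ordConnected_valueSpace hD).isPreconnected.intermediate_value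
      w.2 v.2 (continuousOn_vv hD) ⟨hw, hv⟩
    exact ⟨⟨z, hz⟩, hz0.le, Or.inl hz0⟩

theorem valueLaw_Ioi [IsProbabilityMeasure D] (hD : IsSmoothRegular D f) (y : valueSpace D f) :
    valueLaw D f (Ioi y) = ENNReal.ofReal (1 - cdf D y) := by
  have h : (Ioi y : Set (valueSpace D f)) = Subtype.val ⁻¹' Ioi (y : ℝ) := rfl
  rw [h, ← Measure.map_apply measurable_subtype_coe measurableSet_Ioi, map_valueLaw hD,
    cdf_eq_real, ← probReal_compl_eq_one_sub measurableSet_Iic, compl_Iic, ofReal_measureReal]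

/-- Lebesgue measure on a set of values. -/
noncomputable def lengthOn (T : Set ℝ) : Measure T := volume.comap Subtype.val

theorem sigmaFinite_lengthOn {T : Set ℝ} (hT : MeasurableSet T) : SigmaFinite (lengthOn T) := by
  refine SigmaFinite.of_map _ measurable_subtype_coe.aemeasurable ?_
  rw [lengthOn, map_comap_subtype_coe hT]
  infer_instance

/-- Integrating the survival function `1 - F` against Lebesgue measure is integrating the gap between
value and virtual value against the value distribution. -/
theorem lintegral_mul_one_sub_cdf [IsProbabilityMeasure D] (hD : IsSmoothRegular D f)
    {X : valueSpace D f → ENNReal} (hX : Measurable X) :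
    ∫⁻ y, X y * ENNReal.ofReal (1 - cdf D y) ∂lengthOn (valueSpace D f) =
      ∫⁻ y, X y * ENNReal.ofReal (y - vv D f y) ∂valueLaw D f := by
  have hT := measurableSet_valueSpace hD
  obtain ⟨X, hX', rfl⟩ := (MeasurableEmbedding.subtype_coe hT).exists_measurable_extend hX
    fun _ => inferInstance
  have hF : Measurable fun y => cdf D y := (monotone_cdf (μ := D)).measurable
  have hS := measurableSet_cdf_lt_one (D := D)
  set S := {v | cdf D v < 1}
  let k : ℝ → ENNReal := fun y => X y * ENNReal.ofReal ((1 - cdf D y) / f y)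
  have hk : Measurable k :=
    hX'.mul ((measurable_const.sub hF).div hD.measurable_density).ennreal_ofReal
  have hk0 : ∀ y, y ∉ S → k y = 0 := by
    intro y hy
    have : 1 ≤ cdf D y := not_lt.1 hy
    simp [k, le_antisymm (cdf_le_one (μ := D) y) this]
  calc ∫⁻ y : valueSpace D f, X y * ENNReal.ofReal (1 - cdf D y) ∂lengthOn (valueSpace D f)
      = ∫⁻ y in valueSpace D f, X y * ENNReal.ofReal (1 - cdf D y) :=
        lintegral_subtype_comap hT fun y => X y * ENNReal.ofReal (1 - cdf D y)
    _ = ∫⁻ y in valueSpace D f, ENNReal.ofReal (f y) * S.indicator k y := by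
        refine setLIntegral_congr_fun hT fun y hy => ?_
        by_cases hyS : y ∈ S
        · have hf : f y ≠ 0 := density_ne_zero hy hyS
          simp only [hyS, indicator_of_mem, k]
          rw [mul_comm (ENNReal.ofReal (f y)), mul_assoc, ← ENNReal.ofReal_mul
            (div_nonneg (sub_nonneg.2 (cdf_le_one (μ := D) y)) (hD.density_nonneg y)),
            div_mul_cancel₀ _ hf]
        · have : 1 ≤ cdf D y := not_lt.1 hyS
          simp [hyS, le_antisymm (cdf_le_one (μ := D) y) this]
    _ = ∫⁻ y in valueSpace D f ∩ S, k y ∂volume.withDensity fun v => ENNReal.ofReal (f v) := by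
        have := setLIntegral_withDensity_eq_setLIntegral_mul volume
          hD.measurable_density.ennreal_ofReal (hk.indicator hS) hT
        rw [inter_comm, ← Measure.restrict_restrict hS, ← lintegral_indicator hS, this]
        rfl
    _ = ∫⁻ y in valueSpace D f ∩ S, k y ∂D := by
        rw [← Measure.restrict_restrict hT, ← hD.density, Measure.restrict_restrict hT]
    _ = ∫⁻ y in valueSpace D f, k y ∂D := by
        rw [inter_comm, ← Measure.restrict_restrict hS, ← lintegral_indicator hS]
        refine lintegral_congr fun y => ?_
        by_cases hyS : y ∈ S
        · simp [hyS]
        · simp [hyS, hk0 y hyS]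
    _ = ∫⁻ y : valueSpace D f, k y ∂valueLaw D f := (lintegral_subtype_comap hT k).symm
    _ = _ := by
        refine lintegral_congr fun y => ?_
        simp [k, vv_eq y.2]

/-- The expected information rent of an allocation rule `X` is the expected allocation weighted by
the gap between value and virtual value. -/
theorem lintegral_rent [IsProbabilityMeasure D] (hD : IsSmoothRegular D f)
    {X : valueSpace D f → ENNReal} (hX : Measurable X) :
    ∫⁻ v, ∫⁻ y in Iio v, X y ∂lengthOn (valueSpace D f) ∂valueLaw D f =
      ∫⁻ y, X y * ENNReal.ofReal (y - vv D f y) ∂valueLaw D f := by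
  have hT := measurableSet_valueSpace hD
  have := isProbabilityMeasure_valueLaw hD
  have := sigmaFinite_lengthOn hT
  rw [← lintegral_mul_one_sub_cdf hD hX]
  have h1 : ∀ v : valueSpace D f,
      ∫⁻ y in Iio v, X y ∂lengthOn (valueSpace D f) =
        ∫⁻ y, (Ioi y).indicator (fun _ => X y) v ∂lengthOn (valueSpace D f) := by
    intro v
    rw [← lintegral_indicator measurableSet_Iio]
    rfl
  have hmeas : Measurable (Function.uncurry fun v y : valueSpace D f =>
      (Ioi y).indicator (fun _ => X y) v) := by
    have : (Function.uncurry fun v y : valueSpace D f => (Ioi y).indicator (fun _ => X y) v) =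
        {p : valueSpace D f × valueSpace D f | p.2 < p.1}.indicator fun p => X p.2 := by
      ext p
      rfl
    rw [this]
    exact (hX.comp measurable_snd).indicator (measurableSet_lt measurable_snd measurable_fst)
  simp_rw [h1]
  rw [lintegral_lintegral_swap hmeas.aemeasurable]
  refine lintegral_congr fun y => ?_
  rw [lintegral_indicator measurableSet_Ioi, setLIntegral_const, valueLaw_Ioi hD]

end ValueSpace

/-! ### Information rents -/

section Rent

variable {T : Set ℝ}

theorem image_val_Iio (v : T) : (Subtype.val '' Iio v : Set ℝ) = T ∩ Iio (v : ℝ) := by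
  ext y
  simp only [mem_image, Subtype.exists, exists_and_right, exists_eq_right]
  exact ⟨fun ⟨hy, h⟩ => ⟨hy, h⟩, fun ⟨hy, h⟩ => ⟨hy, h⟩⟩

theorem setLIntegral_lengthOn_congr (hT : MeasurableSet T) {s : Set T} {t : Set ℝ}
    (hst : Subtype.val '' s = t) {X : T → ENNReal} {g : ℝ → ENNReal} (hg : ∀ y : T, g y = X y) :
    ∫⁻ y in s, X y ∂lengthOn T = ∫⁻ y in t, g y := by
  simp_rw [← hg]
  rw [lengthOn, setLIntegral_subtype hT, hst]

/-- The information rent of an allocation rule `X` that serves no negative value, as an interval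
integral and as a Lebesgue integral over the lower values. The two agree for negative `v` too, where
both vanish. -/
theorem intervalIntegral_indicator_eq_rent (hT : MeasurableSet T) {X : T → ℝ} (hX : Measurable X)
    (h0 : ∀ y, 0 ≤ X y) (hneg : ∀ y : T, (y : ℝ) < 0 → X y = 0)
    {g : ℝ → ℝ} (hg : ∀ y : T, g y = X y) (v : T) :
    ∫ y in (0 : ℝ)..(v : ℝ), T.indicator g y =
      (∫⁻ y in Iio v, ENNReal.ofReal (X y) ∂lengthOn T).toReal := by
  have hG : Measurable (T.indicator g) := by
    obtain ⟨X', hX', h⟩ := (MeasurableEmbedding.subtype_coe hT).exists_measurable_extend hX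
      fun _ => inferInstance
    have : T.indicator g = T.indicator X' := by
      refine indicator_congr fun y hy => ?_
      rw [hg ⟨y, hy⟩, ← h]
      rfl
    rw [this]
    exact hX'.indicator hT
  have hG0 : ∀ y, 0 ≤ T.indicator g y := fun y =>
    indicator_nonneg (fun z hz => (h0 ⟨z, hz⟩).trans_eq (hg ⟨z, hz⟩).symm) y
  have hGneg : ∀ y < 0, T.indicator g y = 0 := by
    intro y hy
    by_cases hyT : y ∈ T
    · rw [indicator_of_mem hyT, hg ⟨y, hyT⟩, hneg ⟨y, hyT⟩ hy]
    · exact indicator_of_notMem hyT _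
  have hne : ∀ a : ℝ, ∀ᵐ y : ℝ, y ≠ a := fun a => by simp [ae_iff]
  have key : ∫⁻ y in Iio v, ENNReal.ofReal (X y) ∂lengthOn T =
      ∫⁻ y in Ioc 0 (v : ℝ), ENNReal.ofReal (T.indicator g y) := by
    rw [setLIntegral_lengthOn_congr hT (t := T ∩ Iio (v : ℝ))
      (g := fun y => ENNReal.ofReal (T.indicator g y)) (image_val_Iio v) (fun y => by simp [hg]),
      ← lintegral_indicator measurableSet_Ioc, ← lintegral_indicator (hT.inter measurableSet_Iio)]
    refine lintegral_congr_ae ?_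
    filter_upwards [hne 0, hne v] with y hy0 hyv
    by_cases hyT : y ∈ T
    · rcases lt_or_gt_of_ne hy0 with hy | hy
      · simp [indicator, hyT, hy.not_gt, hg ⟨y, hyT⟩, hneg ⟨y, hyT⟩ hy]
      · have : y < v ↔ y ≤ v := ⟨le_of_lt, fun h => lt_of_le_of_ne h hyv⟩
        simp [indicator, hyT, hy, this]
    · simp [indicator, hyT]
  rw [key]
  rcases le_total 0 (v : ℝ) with hv | hv
  · rw [intervalIntegral.integral_of_le hv, integral_eq_lintegral_of_nonneg_ae
      (Filter.Eventually.of_forall hG0) hG.aestronglyMeasurable]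
  · rw [intervalIntegral.integral_of_ge hv, Ioc_eq_empty (not_lt.2 hv)]
    have : ∫ y in Ioc (v : ℝ) 0, T.indicator g y = 0 := by
      refine integral_eq_zero_of_ae ((ae_restrict_iff' measurableSet_Ioc).2 ?_)
      filter_upwards [hne 0] with y hy0 hy
      exact hGneg y (lt_of_le_of_ne hy.2 hy0)
    simp [this]

theorem rent_le (hT : MeasurableSet T) {X : T → ℝ}
    (h1 : ∀ y, X y ≤ 1) (hneg : ∀ y : T, (y : ℝ) < 0 → X y = 0) (v : T) :
    ∫⁻ y in Iio v, ENNReal.ofReal (X y) ∂lengthOn T ≤ ENNReal.ofReal v := by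
  calc ∫⁻ y in Iio v, ENNReal.ofReal (X y) ∂lengthOn T
      ≤ ∫⁻ y in Iio v, (Ici (0 : ℝ)).indicator (fun _ => 1) (y : ℝ) ∂lengthOn T := by
        refine lintegral_mono fun y => ?_
        rcases lt_or_ge (y : ℝ) 0 with hy | hy
        · simp [hneg y hy]
        · simpa [hy] using h1 y
    _ = ∫⁻ y in T ∩ Iio (v : ℝ), (Ici (0 : ℝ)).indicator (fun _ => 1) y :=
        setLIntegral_lengthOn_congr hT (image_val_Iio v) fun _ => rfl
    _ ≤ ∫⁻ y in Iio (v : ℝ), (Ici (0 : ℝ)).indicator (fun _ => 1) y :=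
        lintegral_mono_set inter_subset_right
    _ = ENNReal.ofReal v := by
        rw [setLIntegral_indicator measurableSet_Ici, setLIntegral_one, Ici_inter_Iio]
        simp

theorem lengthOn_Ico (hT : T.OrdConnected) (a b : T) :
    lengthOn T (Ico a b) = ENNReal.ofReal (b - a) := by
  rw [lengthOn, comap_subtype_coe_apply hT.measurableSet]
  have : (Subtype.val '' Ico a b : Set ℝ) = Ico (a : ℝ) b := by
    ext y
    simp only [mem_image, mem_Ico, Subtype.exists, exists_and_right, exists_eq_right]
    exact ⟨fun ⟨_, h⟩ => h, fun h => ⟨hT.out a.2 b.2 ⟨h.1, h.2.le⟩, h⟩⟩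
  rw [this, Real.volume_Ico]

theorem rent_add (X : T → ENNReal) {a b : T} (hab : a ≤ b) :
    ∫⁻ y in Iio b, X y ∂lengthOn T =
      ∫⁻ y in Iio a, X y ∂lengthOn T + ∫⁻ y in Ico a b, X y ∂lengthOn T := by
  rw [← Iio_union_Ico_eq_Iio hab, lintegral_union measurableSet_Ico]
  exact Set.disjoint_left.2 fun y hy hy' => absurd hy (not_lt.2 hy'.1)

/-- Charging the value of a monotone allocation rule minus its information rent makes truthful
bidding optimal. -/
theorem rent_deviation (hT : T.OrdConnected) {X : T → ℝ} (hX : Monotone X)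
    (hfin : ∀ v, ∫⁻ y in Iio v, ENNReal.ofReal (X y) ∂lengthOn T ≠ ⊤)
    (h0 : ∀ y, 0 ≤ X y) (v b : T) :
    (∫⁻ y in Iio b, ENNReal.ofReal (X y) ∂lengthOn T).toReal + (v - b) * X b ≤
      (∫⁻ y in Iio v, ENNReal.ofReal (X y) ∂lengthOn T).toReal := by
  rcases le_total b v with h | h
  · have hle : (∫⁻ y in Iio b, ENNReal.ofReal (X y) ∂lengthOn T) + ENNReal.ofReal ((v - b) * X b) ≤
        ∫⁻ y in Iio v, ENNReal.ofReal (X y) ∂lengthOn T := by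
      rw [rent_add _ h, ENNReal.ofReal_mul (sub_nonneg.2 h), ← lengthOn_Ico hT, mul_comm]
      gcongr
      rw [← setLIntegral_const]
      exact setLIntegral_mono' measurableSet_Ico fun y hy => ENNReal.ofReal_le_ofReal (hX hy.1)
    rw [← ENNReal.toReal_ofReal (mul_nonneg (sub_nonneg.2 (Subtype.coe_le_coe.2 h)) (h0 b)),
      ← ENNReal.toReal_add (hfin b) ENNReal.ofReal_ne_top]
    exact ENNReal.toReal_mono (hfin v) hle
  · have hle : (∫⁻ y in Iio b, ENNReal.ofReal (X y) ∂lengthOn T) ≤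
        (∫⁻ y in Iio v, ENNReal.ofReal (X y) ∂lengthOn T) + ENNReal.ofReal ((b - v) * X b) := by
      rw [rent_add _ h, ENNReal.ofReal_mul (sub_nonneg.2 h), ← lengthOn_Ico hT, mul_comm]
      gcongr
      rw [← setLIntegral_const]
      exact setLIntegral_mono' measurableSet_Ico fun y hy => ENNReal.ofReal_le_ofReal (hX hy.2.le)
    have := ENNReal.toReal_mono (ENNReal.add_ne_top.2 ⟨hfin v, ENNReal.ofReal_ne_top⟩) hle
    rw [ENNReal.toReal_add (hfin v) ENNReal.ofReal_ne_top,
      ENNReal.toReal_ofReal (mul_nonneg (sub_nonneg.2 (Subtype.coe_le_coe.2 h)) (h0 b))] at this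
    linarith

/-- The envelope inequality on an interval. Averaging `u (y + δ) - u y ≥ δ x y` over `y` bounds the
integral of `x` up to `v - δ`; then `δ` tends to zero. -/
theorem intervalIntegral_le_sub_of_subgradient {u x : ℝ → ℝ} {t v : ℝ} (htv : t ≤ v)
    (h0 : ∀ y ∈ Icc t v, 0 ≤ x y) (h1 : ∀ y ∈ Icc t v, x y ≤ 1)
    (hx : MonotoneOn x (Icc t v))
    (h : ∀ y ∈ Icc t v, ∀ z ∈ Icc t v, u y + (z - y) * x y ≤ u z) :
    ∫ y in t..v, x y ≤ u v - u t := by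
  have hu : MonotoneOn u (Icc t v) := fun y hy z hz hyz => by
    have := h y hy z hz
    nlinarith [h0 y hy]
  have hxi : ∀ {a b : ℝ}, a ∈ Icc t v → b ∈ Icc t v → IntervalIntegrable x volume a b :=
    fun ha hb => (hx.mono (ordConnected_Icc.uIcc_subset ha hb)).intervalIntegrable
  have hui : ∀ {a b : ℝ}, a ∈ Icc t v → b ∈ Icc t v → IntervalIntegrable u volume a b :=
    fun ha hb => (hu.mono (ordConnected_Icc.uIcc_subset ha hb)).intervalIntegrable
  refine le_of_forall_pos_le_add fun ε hε => ?_
  rcases htv.eq_or_lt with rfl | htv'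
  · simp [hε.le]
  set δ := min ε (v - t)
  have hδ0 : 0 < δ := lt_min hε (sub_pos.2 htv')
  have hδv : δ ≤ v - t := min_le_right _ _
  have mt : t ∈ Icc t v := ⟨le_rfl, htv⟩
  have mv : v ∈ Icc t v := ⟨htv, le_rfl⟩
  have mvδ : v - δ ∈ Icc t v := ⟨by linarith, by linarith⟩
  have mtδ : t + δ ∈ Icc t v := ⟨by linarith, by linarith⟩
  have hshift : IntervalIntegrable (fun y => u (y + δ)) volume t (v - δ) := by
    have := (hui mtδ mv).comp_add_right δ
    simpa using this
  have hA : ∫ y in t..(v - δ), δ * x y ≤ ∫ y in t..(v - δ), (u (y + δ) - u y) := by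
    refine intervalIntegral.integral_mono_on mvδ.1 ((hxi mt mvδ).const_mul δ)
      (hshift.sub (hui mt mvδ)) fun y hy => ?_
    have := h y ⟨hy.1, by linarith [hy.2]⟩ (y + δ) ⟨by linarith [hy.1], by linarith [hy.2]⟩
    linarith
  rw [intervalIntegral.integral_const_mul, intervalIntegral.integral_sub hshift (hui mt mvδ),
    intervalIntegral.integral_comp_add_right, sub_add_cancel] at hA
  have hB : ∫ y in (t + δ)..v, u y = (∫ y in t..v, u y) - ∫ y in t..(t + δ), u y := by
    rw [← intervalIntegral.integral_add_adjacent_intervals (hui mt mtδ) (hui mtδ mv)]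
    ring
  have hC : ∫ y in t..(v - δ), u y = (∫ y in t..v, u y) - ∫ y in (v - δ)..v, u y := by
    rw [← intervalIntegral.integral_add_adjacent_intervals (hui mt mvδ) (hui mvδ mv)]
    ring
  have hD : ∫ y in (v - δ)..v, u y ≤ δ * u v := by
    have := intervalIntegral.integral_mono_on (by linarith) (hui mvδ mv)
      (intervalIntegrable_const (c := u v)) fun y hy => hu ⟨by linarith [hy.1], hy.2⟩ mv hy.2
    simpa using this
  have hE : δ * u t ≤ ∫ y in t..(t + δ), u y := by
    have := intervalIntegral.integral_mono_on (by linarith) (intervalIntegrable_const (c := u t))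
      (hui mt mtδ) fun y hy => hu mt ⟨hy.1, by linarith [hy.2]⟩ hy.1
    simpa using this
  have hF : ∫ y in (v - δ)..v, x y ≤ δ := by
    have := intervalIntegral.integral_mono_on (by linarith) (hxi mvδ mv)
      (intervalIntegrable_const (c := (1 : ℝ))) fun y hy => h1 y ⟨by linarith [hy.1], hy.2⟩
    simpa using this
  have hG : ∫ y in t..(v - δ), x y ≤ u v - u t := by
    refine le_of_mul_le_mul_left ?_ hδ0
    linarith
  rw [← intervalIntegral.integral_add_adjacent_intervals (hxi mt mvδ) (hxi mvδ mv)]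
  linarith [min_le_left ε (v - t)]

/-- The envelope inequality: a nonnegative utility `u` for which `X` is a subgradient is at least the
information rent of `X`. -/
theorem rent_le_of_subgradient (hT : T.OrdConnected) {u X : T → ℝ} (hu : ∀ y, 0 ≤ u y)
    (h0 : ∀ y, 0 ≤ X y) (h1 : ∀ y, X y ≤ 1) (hX : Monotone X)
    (h : ∀ y z : T, u y + (z - y) * X y ≤ u z) (v : T) :
    ∫⁻ y in Iio v, ENNReal.ofReal (X y) ∂lengthOn T ≤ ENNReal.ofReal (u v) := by
  have hle : ∀ t ≤ v, ∫⁻ y in Ici t, ENNReal.ofReal (X y) ∂((lengthOn T).restrict (Iio v)) ≤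
      ENNReal.ofReal (u v) := by
    intro t htv
    have hmem : ∀ y ∈ Icc (t : ℝ) v, y ∈ T := fun y hy => hT.out t.2 v.2 hy
    let e : (T → ℝ) → ℝ → ℝ := fun w => Function.extend Subtype.val w 0
    have he : ∀ w (y : T), e w y = w y := fun w y => Subtype.val_injective.extend_apply w 0 y
    have he' : ∀ w (y : ℝ) (hy : y ∈ Icc (t : ℝ) v), e w y = w ⟨y, hmem y hy⟩ :=
      fun w y hy => he w ⟨y, hmem y hy⟩
    have hmono : MonotoneOn (e X) (Icc (t : ℝ) v) := fun y hy z hz hyz => by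
      rw [he' X y hy, he' X z hz]
      exact hX hyz
    have hnn : ∀ y ∈ Icc (t : ℝ) v, 0 ≤ e X y := fun y hy => by rw [he' X y hy]; exact h0 _
    have := intervalIntegral_le_sub_of_subgradient (u := e u) (x := e X) (t := t) (v := v) htv
      hnn (fun y hy => by rw [he' X y hy]; exact h1 _) hmono
      (fun y hy z hz => by rw [he' u y hy, he' X y hy, he' u z hz]; exact h ⟨y, _⟩ ⟨z, _⟩)
    rw [he, he] at this
    have him : Subtype.val '' Ico t v = Ico (t : ℝ) v := by
      ext y
      simp only [mem_image, mem_Ico, Subtype.exists, exists_and_right, exists_eq_right]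
      exact ⟨fun ⟨_, h⟩ => h, fun h => ⟨hmem y ⟨h.1, h.2.le⟩, h⟩⟩
    rw [Measure.restrict_restrict measurableSet_Ici, Ici_inter_Iio,
      setLIntegral_lengthOn_congr hT.measurableSet him (g := fun y => ENNReal.ofReal (e X y))
        (fun y => by rw [he]),
      setLIntegral_congr Ico_ae_eq_Ioc, ← ofReal_integral_eq_lintegral_ofReal,
      ← intervalIntegral.integral_of_le htv]
    · exact ENNReal.ofReal_le_ofReal (by linarith [hu t])
    · have : IntervalIntegrable (e X) volume t v :=
        MonotoneOn.intervalIntegrable (by rwa [uIcc_of_le (Subtype.coe_le_coe.2 htv)])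
      exact (intervalIntegrable_iff_integrableOn_Ioc_of_le htv).1 this
    · exact (ae_restrict_iff' measurableSet_Ioc).2
        (Filter.Eventually.of_forall fun y hy => hnn y ⟨hy.1.le, hy.2⟩)
  have : OrderTopology T := orderTopology_of_ordConnected
  have hne : Nonempty T := ⟨v⟩
  -- the values below `v` are exhausted as `t` tends to the bottom of `T`
  have hlim := (aecover_Ici (μ := (lengthOn T).restrict (Iio v))
    (Filter.tendsto_id (α := T) (x := Filter.atBot))).lintegral_tendsto_of_countably_generated
    (f := fun y => ENNReal.ofReal (X y)) hX.measurable.ennreal_ofReal.aemeasurable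
  exact le_of_tendsto hlim ((Filter.eventually_le_atBot v).mono fun t ht => hle t ht)

end Rent

/-! ### Virtual utilities and user simplicity -/

section VirtualUtility

variable {D : Measure ℝ} {f : ℝ → ℝ}

/-- The vector of virtual values of a vector of values. -/
noncomputable def vvec (D : Measure ℝ) (f : ℝ → ℝ) {n : ℕ} (v : Fin n → valueSpace D f) :
    Fin n → ℝ := fun j => vv D f (v j)

/-- `B` is the block-building process of the virtual-utility functions `U`: allocations are
subgradients of `U` at the virtual values and depend on nothing else, the burn
is the Legendre transform of `U` at the allocation, and a user pays his value for the allocation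
minus his information rent. -/
structure IsProcessOf (B : BlockBuildingProcess (valueSpace D f))
    (U : (n : ℕ) → (Fin n → ℝ) → ℝ) : Prop where
  subgradient : ∀ n (v : Fin n → valueSpace D f), IsSubgradient (U n) (vvec D f v) (B.alloc n v)
  alloc_congr : ∀ n (v w : Fin n → valueSpace D f), vvec D f v = vvec D f w →
    B.alloc n v = B.alloc n w
  pay_eq : ∀ n (v : Fin n → valueSpace D f) i,
    B.pay n v i = v i * B.alloc n v i -
      (∫⁻ y in Iio (v i), ENNReal.ofReal (B.alloc n (Function.update v i y) i)
        ∂lengthOn (valueSpace D f)).toReal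
  burn_eq : ∀ n (v : Fin n → valueSpace D f),
    B.burn n v = ∑ i, vvec D f v i * B.alloc n v i - U n (vvec D f v)
  mono : ∀ n, Monotone (U n)
  neg : ∀ n (v : Fin n → valueSpace D f) i, vv D f (v i) < 0 → B.alloc n v i = 0
  add : ∀ n t (v : Fin n → valueSpace D f) (w : Fin t → valueSpace D f),
    (∀ j, vv D f (w j) ≤ 0) → U n (vvec D f v) = U (n + t) (vvec D f (Fin.append v w))

namespace IsProcessOf

variable {B : BlockBuildingProcess (valueSpace D f)} {U : (n : ℕ) → (Fin n → ℝ) → ℝ}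

theorem measurable_alloc_update (B : BlockBuildingProcess (valueSpace D f)) (n : ℕ)
    (v : Fin n → valueSpace D f) (i : Fin n) :
    Measurable fun y => B.alloc n (Function.update v i y) i :=
  (B.measurable_alloc n i).comp (measurable_update v)

theorem alloc_update_eq_zero (hD : IsSmoothRegular D f) (h : IsProcessOf B U) {n : ℕ}
    (v : Fin n → valueSpace D f) (i : Fin n) (y : valueSpace D f) (hy : (y : ℝ) < 0) :
    B.alloc n (Function.update v i y) i = 0 :=
  h.neg n _ i (by simpa using (vv_le hD y.2).trans_lt hy)

/-- Subgradients are monotone along a coordinate; when two values share their virtual value, the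
subgradient inequalities say nothing, but then the allocations agree. -/
theorem monotone_alloc_update (hD : IsSmoothRegular D f) (h : IsProcessOf B U)
    {n : ℕ} (v : Fin n → valueSpace D f) (i : Fin n) :
    Monotone fun y => B.alloc n (Function.update v i y) i := by
  intro y z hyz
  have hsum : ∀ (g : Fin n → ℝ) (a b : valueSpace D f),
      ∑ j, g j * (vvec D f (Function.update v i b) j - vvec D f (Function.update v i a) j) =
        g i * (vv D f b - vv D f a) := by
    intro g a b
    rw [Finset.sum_eq_single i]
    · simp [vvec]
    · intro j _ hj
      simp [vvec, hj]
    · simp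
  rcases (monotoneOn_vv hD y.2 z.2 hyz).eq_or_lt with heq | hlt
  · refine (congrFun (h.alloc_congr n _ _ ?_) i).le
    ext j
    rcases eq_or_ne j i with rfl | hj
    · simp [vvec, heq]
    · simp [vvec, hj]
  · have h1 := h.subgradient n (Function.update v i y) (vvec D f (Function.update v i z))
    have h2 := h.subgradient n (Function.update v i z) (vvec D f (Function.update v i y))
    rw [hsum] at h1 h2
    change B.alloc n (Function.update v i y) i ≤ B.alloc n (Function.update v i z) i
    nlinarith

/-- A truthful user's utility is his information rent. -/
theorem utility_eq (h : IsProcessOf B U) {n : ℕ} (v : Fin n → valueSpace D f) (i : Fin n) :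
    v i * B.alloc n v i - B.pay n v i =
      (∫⁻ y in Iio (v i), ENNReal.ofReal (B.alloc n (Function.update v i y) i)
        ∂lengthOn (valueSpace D f)).toReal := by
  rw [h.pay_eq]
  ring

theorem rent_alloc_le [IsProbabilityMeasure D] (hD : IsSmoothRegular D f) (h : IsProcessOf B U)
    {n : ℕ} (v : Fin n → valueSpace D f) (i : Fin n) (b : valueSpace D f) :
    ∫⁻ y in Iio b, ENNReal.ofReal (B.alloc n (Function.update v i y) i)
      ∂lengthOn (valueSpace D f) ≤ ENNReal.ofReal b :=
  rent_le (measurableSet_valueSpace hD) (fun _ => (B.alloc_mem _ _ _).2)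
    (h.alloc_update_eq_zero hD v i) b

theorem onChainUserSimple [IsProbabilityMeasure D] (hD : IsSmoothRegular D f)
    (h : IsProcessOf B U) :
    OnChainUserSimple B := by
  intro n v i b
  have := rent_deviation (ordConnected_valueSpace hD) (h.monotone_alloc_update hD v i)
    (fun y => ((h.rent_alloc_le hD v i y).trans_lt ENNReal.ofReal_lt_top).ne)
    (fun y => (B.alloc_mem _ _ _).1) (v i) b
  rw [← h.utility_eq v i] at this
  have hb := h.utility_eq (Function.update v i b) i
  simp only [Function.update_self, Function.update_idem] at hb
  rw [← hb] at this
  linarith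

/-! ### The virtual surplus of an on-chain action -/

/-- The virtual utility inherits its symmetry from the anonymity of the allocation and the burn. -/
theorem U_perm (h : IsProcessOf B U) {n : ℕ} (π : Equiv.Perm (Fin n))
    (v : Fin n → valueSpace D f) : U n (vvec D f (v ∘ π)) = U n (vvec D f v) := by
  have h1 := h.burn_eq n v
  have h2 := h.burn_eq n (v ∘ π)
  rw [B.burn_anonymous, h1] at h2
  have h3 : ∑ i, vvec D f (v ∘ π) i * B.alloc n (v ∘ π) i = ∑ i, vvec D f v i * B.alloc n v i := by
    rw [← Equiv.sum_comp π fun i => vvec D f v i * B.alloc n v i]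
    exact Finset.sum_congr rfl fun i _ => by rw [B.alloc_anonymous]; rfl
  linarith

theorem U_equiv (h : IsProcessOf B U) {n m : ℕ} (e : Fin n ≃ Fin m)
    (v : Fin m → valueSpace D f) : U n (vvec D f (v ∘ e)) = U m (vvec D f v) := by
  obtain rfl : n = m := by simpa using Fintype.card_congr e
  exact h.U_perm e v

theorem U_le (h : IsProcessOf B U) {n : ℕ} {v w : Fin n → valueSpace D f}
    (hvw : ∀ i, vv D f (v i) ≤ vv D f (w i)) : U n (vvec D f v) ≤ U n (vvec D f w) :=
  h.mono n hvw

theorem vv_min_le (hD : IsSmoothRegular D f) (v w : valueSpace D f) :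
    vv D f (min v w : valueSpace D f) ≤ vv D f w :=
  monotoneOn_vv hD (min v w).2 w.2 (min_le_right v w)

/-- Deleting users, adding reserve values and reordering does not increase the virtual utility.
Pad `w` with values `u` below the users' and the reserve value, and `v` with reserve values; the
padded `w` is then, up to the rearrangement `σ`, coordinatewise below the padded `v`. -/
theorem U_slot_le (hD : IsSmoothRegular D f) (h : IsProcessOf B U) {n N : ℕ}
    {slot : Fin n → Option (Fin N)}
    (hinj : ∀ i i' j, slot i = some j → slot i' = some j → i = i') {w₀ : valueSpace D f}
    (hw₀ : vv D f w₀ ≤ 0) (v : Fin n → valueSpace D f) (w : Fin N → valueSpace D f)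
    (hw : ∀ i j, slot i = some j → w j = v i) (hw' : ∀ j, (∀ i, slot i ≠ some j) → w j = w₀) :
    U N (vvec D f w) ≤ U n (vvec D f v) := by
  classical
  -- the involution of `Fin N ⊕ Fin n` that exchanges every user with his slot
  let σ : Fin N ⊕ Fin n → Fin N ⊕ Fin n := Sum.elim
    (fun j => if hj : ∃ i, slot i = some j then Sum.inr hj.choose else Sum.inl j)
    (fun i => (slot i).elim (Sum.inr i) Sum.inl)
  have σ_slot : ∀ i j, slot i = some j → σ (Sum.inl j) = Sum.inr i := by
    intro i j hij
    have hj : ∃ i, slot i = some j := ⟨i, hij⟩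
    simp only [σ, Sum.elim_inl, hj, dif_pos]
    rw [hinj _ _ _ hj.choose_spec hij]
  have σ_free : ∀ j, (∀ i, slot i ≠ some j) → σ (Sum.inl j) = Sum.inl j := by
    intro j hj
    simp [σ, hj]
  have σ_some : ∀ i j, slot i = some j → σ (Sum.inr i) = Sum.inl j := by
    intro i j hij
    simp [σ, hij]
  have σ_none : ∀ i, slot i = none → σ (Sum.inr i) = Sum.inr i := by
    intro i hi
    simp [σ, hi]
  have hσ : Function.Involutive σ := by
    rintro (j | i)
    · by_cases hj : ∃ i, slot i = some j
      · obtain ⟨i, hi⟩ := hj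
        rw [σ_slot i j hi, σ_some i j hi]
      · push Not at hj
        rw [σ_free j hj, σ_free j hj]
    · cases hi : slot i with
      | none => rw [σ_none i hi, σ_none i hi]
      | some j => rw [σ_some i j hi, σ_slot i j hi]
  let u : Fin n → valueSpace D f := fun i => min (v i) w₀
  have hu : ∀ i, vv D f (u i) ≤ vv D f w₀ := fun i => vv_min_le hD _ _
  have hu' : ∀ i, vv D f (u i) ≤ vv D f (v i) := fun i => by
    simp only [u, min_comm (v i)]
    exact vv_min_le hD _ _
  have happ : ∀ (a : Fin N → valueSpace D f) (b : Fin n → valueSpace D f),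
      Sum.elim a b ∘ finSumFinEquiv.symm = Fin.append a b := by
    intro a b
    ext k
    refine Fin.addCases (fun j => ?_) (fun i => ?_) k <;> simp
  let e : Equiv.Perm (Fin (N + n)) :=
    (finSumFinEquiv.symm.trans (Function.Involutive.toPerm σ hσ)).trans finSumFinEquiv
  calc U N (vvec D f w) = U (N + n) (vvec D f (Fin.append w u)) :=
        h.add N n w u fun j => (hu j).trans hw₀
    _ = U (N + n) (vvec D f (Fin.append w u ∘ e)) := (h.U_perm e _).symm
    _ ≤ U (N + n) (vvec D f (Fin.append (fun _ => w₀) v)) := by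
        rw [← happ, ← happ]
        refine h.U_le fun k => ?_
        simp only [Function.comp_apply, e, Equiv.trans_apply, Equiv.symm_apply_apply,
          Function.Involutive.coe_toPerm]
        rcases finSumFinEquiv.symm k with j | i
        · by_cases hj : ∃ i, slot i = some j
          · obtain ⟨i, hi⟩ := hj
            simpa [σ_slot i j hi] using hu i
          · push Not at hj
            simp [σ_free j hj, hw' j hj]
        · cases hi : slot i with
          | none => simpa [σ_none i hi] using hu' i
          | some j => simp [σ_some i j hi, hw i j hi]
    _ = U (n + N) (vvec D f (Fin.append v fun _ => w₀)) := by
        rw [← h.U_equiv (finAddFlip : Fin (N + n) ≃ Fin (n + N))]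
        congr 2
        ext k
        refine Fin.addCases (fun j => ?_) (fun i => ?_) k <;> simp
    _ = U n (vvec D f v) := (h.add n N v _ fun _ => hw₀).symm

/-- No on-chain action yields a larger virtual surplus net of the burn than the truthful one, whose
virtual surplus is `U n (vvec D f v)`. The burn is convex conjugate to `U`, so the subgradient
inequality at the bids submitted bounds the surplus by the virtual utility of the profile that holds
the users' true values in their slots and the reserve value in all others. -/
theorem virtualSurplus_le [IsProbabilityMeasure D] (hD : IsSmoothRegular D f)
    (h : IsProcessOf B U) {n : ℕ} (a : OnChainAction (valueSpace D f) n)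
    (v : Fin n → valueSpace D f) :
    ∑ i, vv D f (v i) * a.userAlloc B i - a.burn B ≤ U n (vvec D f v) := by
  classical
  obtain ⟨w₀, hw₀, hw₀'⟩ := exists_reserve hD
  -- fabricated bids contribute nothing to the virtual surplus at the reserve value
  have hzero : ∀ j, vv D f w₀ * B.alloc a.numBids a.bid j = 0 := by
    intro j
    rcases hw₀' with h0 | hneg
    · rw [h0, zero_mul]
    · rw [h.neg _ _ _ (hneg _), mul_zero]
  -- the users' true values in their own slots, reserve values in the fabricated ones
  let w : Fin a.numBids → valueSpace D f := fun j =>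
    if hj : ∃ i, a.slot i = some j then v hj.choose else w₀
  have hw : ∀ i j, a.slot i = some j → w j = v i := by
    intro i j hij
    have hj : ∃ i, a.slot i = some j := ⟨i, hij⟩
    simp only [w, hj, dif_pos]
    rw [a.slot_injective _ _ _ hj.choose_spec hij]
  have hw' : ∀ j, (∀ i, a.slot i ≠ some j) → w j = w₀ := by
    intro j hj
    simp [w, hj]
  have hsum : ∑ i, vv D f (v i) * a.userAlloc B i =
      ∑ j, vv D f (w j) * B.alloc a.numBids a.bid j := by
    have h1 : ∀ i, vv D f (v i) * a.userAlloc B i =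
        ∑ j, if a.slot i = some j then vv D f (w j) * B.alloc a.numBids a.bid j else 0 := by
      intro i
      cases hi : a.slot i with
      | none => simp [OnChainAction.userAlloc, hi]
      | some j => simp [OnChainAction.userAlloc, hi, hw i j hi]
    simp_rw [h1]
    rw [Finset.sum_comm]
    refine Finset.sum_congr rfl fun j _ => ?_
    by_cases hj : ∃ i, a.slot i = some j
    · obtain ⟨i, hi⟩ := hj
      rw [Finset.sum_eq_single i]
      · simp [hi]
      · intro i' _ hne
        exact if_neg fun hi' => hne (a.slot_injective _ _ _ hi' hi)
      · simp
    · push Not at hj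
      simp [hj, hw' j hj, hzero]
  have hsub := h.subgradient a.numBids a.bid (vvec D f w)
  have hburn := h.burn_eq a.numBids a.bid
  have hle := h.U_slot_le hD a.slot_injective hw₀ v w hw hw'
  have hsplit : ∑ j, B.alloc a.numBids a.bid j * (vvec D f w j - vvec D f a.bid j) =
      ∑ j, vv D f (w j) * B.alloc a.numBids a.bid j -
        ∑ j, vvec D f a.bid j * B.alloc a.numBids a.bid j := by
    rw [← Finset.sum_sub_distrib]
    exact Finset.sum_congr rfl fun j _ => by simp only [vvec]; ring
  rw [hsum, OnChainAction.burn, hburn]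
  linarith

end IsProcessOf

end VirtualUtility

/-! ### Resampling one coordinate -/

section Resample

variable {α : Type*} [MeasurableSpace α] (μ : Measure α) [IsProbabilityMeasure μ] {n : ℕ}

/-- Redrawing one coordinate of an i.i.d. profile does not change its law. -/
theorem measurePreserving_update_pi (i : Fin n) :
    MeasurePreserving (fun p : α × (Fin n → α) => Function.update p.2 i p.1)
      (μ.prod (Measure.pi fun _ => μ)) (Measure.pi fun _ => μ) := by
  have hmeas : Measurable fun p : α × (Fin n → α) => Function.update p.2 i p.1 := by
    refine measurable_pi_iff.2 fun j => ?_
    rcases eq_or_ne j i with rfl | hj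
    · simpa using measurable_fst
    · simp only [Function.update_of_ne hj]
      exact (measurable_pi_apply j).comp measurable_snd
  refine ⟨hmeas, (Measure.pi_eq fun s hs => ?_).symm⟩
  have hpre : (fun p : α × (Fin n → α) => Function.update p.2 i p.1) ⁻¹' univ.pi s =
      s i ×ˢ univ.pi (Function.update s i univ) := by
    ext p
    simp only [mem_preimage, mem_pi, mem_univ, true_imp_iff, mem_prod]
    refine ⟨fun h => ⟨by simpa using h i, fun j => ?_⟩, fun h j => ?_⟩
    · rcases eq_or_ne j i with rfl | hj
      · simp
      · simpa [hj] using h j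
    · rcases eq_or_ne j i with rfl | hj
      · simpa using h.1
      · simpa [hj] using h.2 j
  rw [Measure.map_apply hmeas (MeasurableSet.univ_pi hs), hpre, Measure.prod_prod, Measure.pi_pi,
    ← Finset.mul_prod_erase _ _ (Finset.mem_univ i),
    ← Finset.mul_prod_erase (a := i) _ (fun j => μ (s j)) (Finset.mem_univ i)]
  simp only [Function.update_self, measure_univ, one_mul]
  congr 1
  exact Finset.prod_congr rfl fun j hj => by simp [Finset.ne_of_mem_erase hj]

theorem measurePreserving_update_prod (i : Fin n) {S : Type*} [MeasurableSpace S]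
    (ν : Measure S) [IsProbabilityMeasure ν] :
    MeasurePreserving (fun p : α × ((Fin n → α) × S) => (Function.update p.2.1 i p.1, p.2.2))
      (μ.prod ((Measure.pi fun _ => μ).prod ν)) ((Measure.pi fun _ => μ).prod ν) :=
  ((measurePreserving_update_pi μ i).prod (MeasurePreserving.id ν)).comp
    (measurePreserving_prodAssoc μ (Measure.pi fun _ => μ) ν).symm

end Resample

/-! ### Revenue and virtual surplus -/

section Myerson

variable {D : Measure ℝ} {f : ℝ → ℝ}

/-- Expected payments are at most virtual surplus. `A` and `P` are the allocation and the payment of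
a user whose value is `c`, in a random state with law `L`, and `Φ (v, ·)` replaces his value by `v`.
The hypotheses `hbest` and `hpart` say that acting on his true value is optimal for him and leaves
him a nonnegative interim utility. -/
theorem integral_pay_le_virtual [IsProbabilityMeasure D] (hD : IsSmoothRegular D f)
    (hmean : Integrable (fun v : ℝ => v) D) {Ω : Type*} [MeasurableSpace Ω] {L : Measure Ω}
    [IsProbabilityMeasure L] {Φ : valueSpace D f × Ω → Ω}
    (hΦ : MeasurePreserving Φ ((valueLaw D f).prod L) L) {c : Ω → valueSpace D f}
    (hc : Measurable c) (hcΦ : ∀ v z, c (Φ (v, z)) = v) {A P : Ω → ℝ}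
    (hA : Integrable A L) (hP : Integrable P L) (hA0 : ∀ z, 0 ≤ A z) (hA1 : ∀ z, A z ≤ 1)
    (hAΦ : ∀ v, Integrable (fun z => A (Φ (v, z))) L)
    (hbest : ∀ v w : valueSpace D f,
      v * (∫ z, A (Φ (w, z)) ∂L) - ∫ z, P (Φ (w, z)) ∂L ≤
        v * (∫ z, A (Φ (v, z)) ∂L) - ∫ z, P (Φ (v, z)) ∂L)
    (hpart : ∀ v : valueSpace D f,
      0 ≤ v * (∫ z, A (Φ (v, z)) ∂L) - ∫ z, P (Φ (v, z)) ∂L) :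
    Integrable (fun z => vv D f (c z) * A z) L ∧
      ∫ z, P z ∂L ≤ ∫ z, vv D f (c z) * A z ∂L := by
  have := isProbabilityMeasure_valueLaw hD
  set μ := valueLaw D f
  set X : valueSpace D f → ℝ := fun v => ∫ z, A (Φ (v, z)) ∂L with hXdef
  set Q : valueSpace D f → ℝ := fun v => ∫ z, P (Φ (v, z)) ∂L
  set u : valueSpace D f → ℝ := fun v => v * X v - Q v with hudef
  have hX0 : ∀ v, 0 ≤ X v := fun v => integral_nonneg fun z => hA0 _
  have hX1 : ∀ v, X v ≤ 1 := fun v => by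
    have := integral_mono (hAΦ v) (integrable_const (1 : ℝ)) fun z => hA1 _
    simpa using this
  have hX : Monotone X := by
    intro v w hvw
    rcases hvw.eq_or_lt with rfl | hlt
    · exact le_rfl
    · have h1 := hbest v w
      have h2 := hbest w v
      have h3 : (v : ℝ) < w := hlt
      by_contra! h4
      nlinarith
  have hval := integrable_val_valueLaw hD hmean
  have hcmap : MeasurePreserving c L μ := by
    refine ⟨hc, ?_⟩
    conv_lhs => rw [← hΦ.map_eq]
    rw [Measure.map_map hc hΦ.measurable]
    have : c ∘ Φ = Prod.fst := funext fun p => hcΦ p.1 p.2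
    rw [this, measurePreserving_fst.map_eq]
  have hcint : Integrable (fun z => (c z : ℝ)) L := hcmap.integrable_comp_of_integrable hval
  have hcA : Integrable (fun z => (c z : ℝ) * A z) L := by
    refine hcint.mul_bdd (c := 1) hA.aestronglyMeasurable (Filter.Eventually.of_forall fun z => ?_)
    rw [Real.norm_eq_abs, abs_of_nonneg (hA0 z)]
    exact hA1 z
  -- averages over a resampled value
  have hres : ∀ F : Ω → ℝ, Integrable F L → ∫ z, F z ∂L = ∫ v, ∫ z, F (Φ (v, z)) ∂L ∂μ := by
    intro F hF
    have hF' : AEStronglyMeasurable F (Measure.map Φ (μ.prod L)) := by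
      rw [hΦ.map_eq]; exact hF.aestronglyMeasurable
    rw [← integral_prod (fun p => F (Φ p)) (hΦ.integrable_comp_of_integrable hF),
      ← integral_map hΦ.measurable.aemeasurable hF', hΦ.map_eq]
  have hQint : Integrable Q μ := (hΦ.integrable_comp_of_integrable hP).integral_prod_left
  have hvX : Integrable (fun v : valueSpace D f => v * X v) μ := by
    refine hval.mul_bdd (c := 1) hX.measurable.aestronglyMeasurable
      (Filter.Eventually.of_forall fun v => ?_)
    rw [Real.norm_eq_abs, abs_of_nonneg (hX0 v)]
    exact hX1 v
  have huint : Integrable u μ := hvX.sub hQint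
  have hrent : ∀ v, ∫⁻ y in Iio v, ENNReal.ofReal (X y) ∂lengthOn (valueSpace D f) ≤
      ENNReal.ofReal (u v) := by
    refine rent_le_of_subgradient (ordConnected_valueSpace hD) hpart hX0 hX1 hX fun y z => ?_
    have := hbest z y
    simp only [hudef]
    linarith
  -- the information rent in terms of the virtual value
  let G : Ω → ℝ := fun z => (c z - vv D f (c z)) * A z
  have hgap : ∀ v : valueSpace D f, 0 ≤ (v : ℝ) - vv D f v := fun v => sub_nonneg.2 (vv_le hD v.2)
  have hG0 : ∀ z, 0 ≤ G z := fun z => mul_nonneg (hgap _) (hA0 z)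
  have hGm : AEStronglyMeasurable G L :=
    ((measurable_subtype_coe.comp hc).sub
      ((measurable_vv hD).comp hc)).aestronglyMeasurable.mul hA.aestronglyMeasurable
  have hGle : ∫⁻ z, ENNReal.ofReal (G z) ∂L ≤ ∫⁻ v, ENNReal.ofReal (u v) ∂μ := by
    have hGm' : AEMeasurable (fun z => ENNReal.ofReal (G z)) (Measure.map Φ (μ.prod L)) := by
      rw [hΦ.map_eq]; exact hGm.aemeasurable.ennreal_ofReal
    calc ∫⁻ z, ENNReal.ofReal (G z) ∂L
        = ∫⁻ v, ∫⁻ z, ENNReal.ofReal (G (Φ (v, z))) ∂L ∂μ := by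
          conv_lhs => rw [← hΦ.map_eq]
          rw [lintegral_map' hGm' hΦ.measurable.aemeasurable,
            lintegral_prod (fun p => ENNReal.ofReal (G (Φ p)))
              (hGm'.comp_measurable hΦ.measurable)]
      _ = ∫⁻ v, ENNReal.ofReal (X v) * ENNReal.ofReal (v - vv D f v) ∂μ := by
          refine lintegral_congr fun v => ?_
          simp only [G, hcΦ, ENNReal.ofReal_mul (hgap v)]
          rw [lintegral_const_mul' _ _ ENNReal.ofReal_ne_top,
            ← ofReal_integral_eq_lintegral_ofReal (hAΦ v)
              (Filter.Eventually.of_forall fun z => hA0 _), mul_comm]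
      _ = ∫⁻ v, ∫⁻ y in Iio v, ENNReal.ofReal (X y) ∂lengthOn (valueSpace D f) ∂μ :=
          (lintegral_rent hD hX.measurable.ennreal_ofReal).symm
      _ ≤ ∫⁻ v, ENNReal.ofReal (u v) ∂μ := lintegral_mono hrent
  have hu_eq := ofReal_integral_eq_lintegral_ofReal huint (Filter.Eventually.of_forall hpart)
  have hGint : Integrable G L := by
    refine ⟨hGm, ?_⟩
    rw [hasFiniteIntegral_iff_ofReal (Filter.Eventually.of_forall hG0)]
    exact hGle.trans_lt (hu_eq ▸ ENNReal.ofReal_lt_top)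
  have hGu : ∫ z, G z ∂L ≤ ∫ v, u v ∂μ := by
    rw [← hu_eq, ← ofReal_integral_eq_lintegral_ofReal hGint (Filter.Eventually.of_forall hG0)]
      at hGle
    exact (ENNReal.ofReal_le_ofReal_iff (integral_nonneg hpart)).1 hGle
  have heq : (fun z => vv D f (c z) * A z) = fun z => (c z : ℝ) * A z - G z := by
    ext z
    simp only [G]
    ring
  refine ⟨heq ▸ hcA.sub hGint, ?_⟩
  have hcAv : ∫ z, (c z : ℝ) * A z ∂L = ∫ v : valueSpace D f, v * X v ∂μ := by
    rw [hres _ hcA]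
    simp only [hcΦ, integral_const_mul, hXdef]
  rw [heq, integral_sub hcA hGint, hcAv, hres P hP]
  have : ∫ v, u v ∂μ = ∫ v : valueSpace D f, v * X v ∂μ - ∫ v, Q v ∂μ := integral_sub hvX hQint
  linarith

end Myerson

theorem OnChainAction.userAlloc_mem {T : Set ℝ} (B : BlockBuildingProcess T) {n : ℕ}
    (a : OnChainAction T n) (i : Fin n) : a.userAlloc B i ∈ Icc (0 : ℝ) 1 := by
  cases hi : a.slot i with
  | none => simp [OnChainAction.userAlloc, hi]
  | some j => simpa [OnChainAction.userAlloc, hi] using B.alloc_mem a.numBids a.bid j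

namespace IsProcessOf

variable {D : Measure ℝ} {f : ℝ → ℝ} {B : BlockBuildingProcess (valueSpace D f)}
  {U : (n : ℕ) → (Fin n → ℝ) → ℝ}

/-! ### The truthful outcome -/

theorem virtual_mul_alloc_nonneg (h : IsProcessOf B U) {n : ℕ} (v : Fin n → valueSpace D f)
    (i : Fin n) : 0 ≤ vv D f (v i) * B.alloc n v i := by
  rcases lt_or_ge (vv D f (v i)) 0 with hi | hi
  · rw [h.neg n v i hi, mul_zero]
  · exact mul_nonneg hi (B.alloc_mem _ _ _).1

theorem virtual_mul_alloc_le (hD : IsSmoothRegular D f) (h : IsProcessOf B U) {n : ℕ}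
    (v : Fin n → valueSpace D f) (i : Fin n) : vv D f (v i) * B.alloc n v i ≤ |(v i : ℝ)| := by
  rcases lt_or_ge (vv D f (v i)) 0 with hi | hi
  · rw [h.neg n v i hi, mul_zero]
    exact abs_nonneg _
  · exact (mul_le_of_le_one_right hi (B.alloc_mem _ _ _).2).trans
      ((vv_le hD (v i).2).trans (le_abs_self _))

theorem utility_nonneg (h : IsProcessOf B U) {n : ℕ} (v : Fin n → valueSpace D f) (i : Fin n) :
    0 ≤ v i * B.alloc n v i - B.pay n v i := by
  rw [h.utility_eq]
  exact ENNReal.toReal_nonneg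

variable [IsProbabilityMeasure D]

theorem abs_pay_le (hD : IsSmoothRegular D f) (h : IsProcessOf B U) {n : ℕ}
    (v : Fin n → valueSpace D f) (i : Fin n) : |B.pay n v i| ≤ 2 * |(v i : ℝ)| := by
  have h0 := h.utility_nonneg v i
  have h1 : v i * B.alloc n v i - B.pay n v i ≤ |(v i : ℝ)| := by
    rw [h.utility_eq]
    exact ENNReal.toReal_le_of_le_ofReal (abs_nonneg _)
      ((h.rent_alloc_le hD v i (v i)).trans (ENNReal.ofReal_le_ofReal (le_abs_self _)))
  have h2 : |v i * B.alloc n v i| ≤ |(v i : ℝ)| := by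
    rw [abs_mul, abs_of_nonneg (B.alloc_mem n v i).1]
    exact mul_le_of_le_one_right (abs_nonneg _) (B.alloc_mem n v i).2
  rw [abs_le] at h2 ⊢
  constructor <;> linarith

/-- The virtual utility is minimal at reserve values, which bounds the burn on both sides. -/
theorem exists_abs_burn_le (hD : IsSmoothRegular D f) (h : IsProcessOf B U) (n : ℕ) :
    ∃ C : ℝ, ∀ v : Fin n → valueSpace D f, |B.burn n v| ≤ ∑ i, |(v i : ℝ)| + C := by
  obtain ⟨w₀, hw₀⟩ := exists_vv_nonpos hD
  set c := U n (vvec D f fun _ => w₀)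
  refine ⟨n * |vv D f w₀| + |c|, fun v => ?_⟩
  have hc : c ≤ U n (vvec D f v) :=
    h.U_slot_le hD (slot := fun _ => none) (by simp) hw₀ v _ (by simp) (by simp)
  have hsub : U n (vvec D f v) + ∑ i, B.alloc n v i * (vv D f w₀ - vv D f (v i)) ≤ c :=
    h.subgradient n v (vvec D f fun _ => w₀)
  have hsplit : ∑ i, B.alloc n v i * (vv D f w₀ - vv D f (v i)) =
      ∑ i, B.alloc n v i * vv D f w₀ - ∑ i, vv D f (v i) * B.alloc n v i := by
    rw [← Finset.sum_sub_distrib]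
    exact Finset.sum_congr rfl fun i _ => by ring
  have hlow : -(n * |vv D f w₀|) ≤ ∑ i, B.alloc n v i * vv D f w₀ := by
    have : ∑ _i : Fin n, -|vv D f w₀| ≤ ∑ i, B.alloc n v i * vv D f w₀ := by
      refine Finset.sum_le_sum fun i _ => ?_
      have := B.alloc_mem n v i
      nlinarith [neg_abs_le (vv D f w₀), this.1, this.2, abs_nonneg (vv D f w₀)]
    simpa using this
  have hup : ∑ i, vv D f (v i) * B.alloc n v i ≤ ∑ i, |(v i : ℝ)| :=
    Finset.sum_le_sum fun i _ => h.virtual_mul_alloc_le hD v i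
  have hburn : B.burn n v = ∑ i, vv D f (v i) * B.alloc n v i - U n (vvec D f v) := h.burn_eq n v
  have hnn : 0 ≤ ∑ i, |(v i : ℝ)| := Finset.sum_nonneg fun i _ => abs_nonneg _
  have hn : 0 ≤ n * |vv D f w₀| := by positivity
  rw [abs_le, hburn]
  constructor <;> linarith [abs_le.1 (le_refl |c|)]

section Integrability

variable (hD : IsSmoothRegular D f) (hmean : Integrable (fun v : ℝ => v) D)
include hD hmean

theorem integrable_abs_coord {n : ℕ} (i : Fin n) :
    Integrable (fun v : Fin n → valueSpace D f => |(v i : ℝ)|)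
      (Measure.pi fun _ => valueLaw D f) := by
  have := isProbabilityMeasure_valueLaw hD
  exact ((measurePreserving_eval (fun _ : Fin n => valueLaw D f) i).integrable_comp_of_integrable
    (integrable_val_valueLaw hD hmean)).abs

theorem integrable_pay (h : IsProcessOf B U) {n : ℕ} (i : Fin n) :
    Integrable (fun v => B.pay n v i) (Measure.pi fun _ => valueLaw D f) :=
  ((integrable_abs_coord hD hmean i).const_mul 2).mono'
    (B.measurable_pay n i).aestronglyMeasurable
    (Filter.Eventually.of_forall fun v => h.abs_pay_le hD v i)

theorem integrable_burn (h : IsProcessOf B U) (n : ℕ) :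
    Integrable (B.burn n) (Measure.pi fun _ => valueLaw D f) := by
  have := isProbabilityMeasure_valueLaw hD
  obtain ⟨C, hC⟩ := h.exists_abs_burn_le hD n
  exact ((integrable_finsetSum _ fun i _ => integrable_abs_coord hD hmean i).add
    (integrable_const C)).mono' (B.measurable_burn n).aestronglyMeasurable
    (Filter.Eventually.of_forall hC)

theorem integrable_virtual_mul_alloc (h : IsProcessOf B U) {n : ℕ} (i : Fin n) :
    Integrable (fun v => vv D f (v i) * B.alloc n v i) (Measure.pi fun _ => valueLaw D f) := by
  refine (integrable_abs_coord hD hmean i).mono'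
    (((measurable_vv hD).comp (measurable_pi_apply i)).mul
      (B.measurable_alloc n i)).aestronglyMeasurable (Filter.Eventually.of_forall fun v => ?_)
  rw [Real.norm_eq_abs, abs_of_nonneg (h.virtual_mul_alloc_nonneg v i)]
  exact h.virtual_mul_alloc_le hD v i

theorem integrable_U (h : IsProcessOf B U) (n : ℕ) :
    Integrable (fun v => U n (vvec D f v)) (Measure.pi fun _ => valueLaw D f) := by
  have := (integrable_finsetSum Finset.univ fun i _ =>
    h.integrable_virtual_mul_alloc hD hmean (n := n) i).sub (h.integrable_burn hD hmean n)
  refine this.congr (Filter.Eventually.of_forall fun v => ?_)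
  simp only [Pi.sub_apply, h.burn_eq]
  simp [vvec]

/-- Under truthful bidding, revenue equals virtual surplus: the payments leave the users exactly
their information rents. -/
theorem integral_pay_eq_virtual (h : IsProcessOf B U) {n : ℕ} (i : Fin n) :
    ∫ v, B.pay n v i ∂(Measure.pi fun _ => valueLaw D f) =
      ∫ v, vv D f (v i) * B.alloc n v i ∂(Measure.pi fun _ => valueLaw D f) := by
  have := isProbabilityMeasure_valueLaw hD
  set μ := valueLaw D f
  set ρ := Measure.pi fun _ : Fin n => μ
  let Φ : valueSpace D f × (Fin n → valueSpace D f) → Fin n → valueSpace D f :=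
    fun p => Function.update p.2 i p.1
  have hΦ : MeasurePreserving Φ (μ.prod ρ) ρ := measurePreserving_update_pi μ i
  have hres : ∀ F : (Fin n → valueSpace D f) → ENNReal, Measurable F →
      ∫⁻ v, F v ∂ρ = ∫⁻ z, ∫⁻ y, F (Function.update z i y) ∂μ ∂ρ := by
    intro F hF
    rw [← hΦ.lintegral_comp hF, lintegral_prod_symm' (fun p => F (Φ p)) (hF.comp hΦ.measurable)]
  let u : (Fin n → valueSpace D f) → ℝ := fun v => v i * B.alloc n v i - B.pay n v i
  let G : (Fin n → valueSpace D f) → ℝ := fun v => (v i - vv D f (v i)) * B.alloc n v i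
  have hcoord : Measurable fun v : Fin n → valueSpace D f => (v i : ℝ) :=
    measurable_subtype_coe.comp (measurable_pi_apply i)
  have hum : Measurable u := (hcoord.mul (B.measurable_alloc n i)).sub (B.measurable_pay n i)
  have hGm : Measurable G :=
    (hcoord.sub ((measurable_vv hD).comp (measurable_pi_apply i))).mul (B.measurable_alloc n i)
  have hgap : ∀ v : valueSpace D f, 0 ≤ (v : ℝ) - vv D f v := fun v => sub_nonneg.2 (vv_le hD v.2)
  have hkey : ∫⁻ v, ENNReal.ofReal (u v) ∂ρ = ∫⁻ v, ENNReal.ofReal (G v) ∂ρ := by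
    rw [hres _ hum.ennreal_ofReal, hres _ hGm.ennreal_ofReal]
    refine lintegral_congr fun z => ?_
    have := lintegral_rent hD (measurable_alloc_update B n z i).ennreal_ofReal
    calc ∫⁻ y, ENNReal.ofReal (u (Function.update z i y)) ∂μ
        = ∫⁻ v, ∫⁻ y in Iio v, ENNReal.ofReal (B.alloc n (Function.update z i y) i)
            ∂lengthOn (valueSpace D f) ∂μ := by
          refine lintegral_congr fun v => ?_
          simp only [u, h.utility_eq, Function.update_self, Function.update_idem]
          exact ENNReal.ofReal_toReal
            ((h.rent_alloc_le hD z i v).trans_lt ENNReal.ofReal_lt_top).ne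
      _ = ∫⁻ y, ENNReal.ofReal (G (Function.update z i y)) ∂μ := by
          rw [this]
          refine lintegral_congr fun y => ?_
          simp only [G, Function.update_self, ENNReal.ofReal_mul (hgap y)]
          rw [mul_comm]
  have hu_int : ∫ v, u v ∂ρ = ∫ v, G v ∂ρ := by
    rw [integral_eq_lintegral_of_nonneg_ae
        (Filter.Eventually.of_forall fun v => h.utility_nonneg v i) hum.aestronglyMeasurable,
      integral_eq_lintegral_of_nonneg_ae
        (Filter.Eventually.of_forall fun v => mul_nonneg (hgap _) (B.alloc_mem _ _ _).1)
        hGm.aestronglyMeasurable, hkey]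
  have hcA : Integrable (fun v : Fin n → valueSpace D f => v i * B.alloc n v i) ρ := by
    refine (integrable_abs_coord hD hmean i).mono'
      (hcoord.mul (B.measurable_alloc n i)).aestronglyMeasurable
      (Filter.Eventually.of_forall fun v => ?_)
    rw [Real.norm_eq_abs, abs_mul, abs_of_nonneg (B.alloc_mem n v i).1]
    exact mul_le_of_le_one_right (abs_nonneg _) (B.alloc_mem n v i).2
  have h1 : ∫ v, u v ∂ρ =
      ∫ v : Fin n → valueSpace D f, v i * B.alloc n v i ∂ρ - ∫ v, B.pay n v i ∂ρ :=
    integral_sub hcA (h.integrable_pay hD hmean i)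
  have h2 : ∫ v, G v ∂ρ = ∫ v : Fin n → valueSpace D f, v i * B.alloc n v i ∂ρ -
      ∫ v, vv D f (v i) * B.alloc n v i ∂ρ := by
    rw [← integral_sub hcA (h.integrable_virtual_mul_alloc hD hmean i)]
    exact integral_congr_ae (Filter.Eventually.of_forall fun v => by simp only [G]; ring)
  linarith

theorem trivial_isUserBNE (h : IsProcessOf B U) (hsimple : OnChainUserSimple B) (n : ℕ) :
    (OffChainMechanism.trivial (valueSpace D f) n).IsUserBNE B (valueLaw D f) fun _ x => x := by
  have := isProbabilityMeasure_valueLaw hD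
  have halloc : ∀ i, Integrable (fun v => B.alloc n v i) (Measure.pi fun _ => valueLaw D f) :=
    fun i => (integrable_const (1 : ℝ)).mono' (B.measurable_alloc n i).aestronglyMeasurable
      (Filter.Eventually.of_forall fun v => by
        rw [Real.norm_eq_abs, abs_of_nonneg (B.alloc_mem n v i).1]
        exact (B.alloc_mem n v i).2)
  have hallocd : ∀ i (m : valueSpace D f), Integrable
      (fun v => B.alloc n (Function.update v i m) i) (Measure.pi fun _ => valueLaw D f) :=
    fun i m => (integrable_const (1 : ℝ)).mono'
      ((B.measurable_alloc n i).comp measurable_update_left).aestronglyMeasurable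
      (Filter.Eventually.of_forall fun v => by
        rw [Real.norm_eq_abs, abs_of_nonneg (B.alloc_mem n _ i).1]
        exact (B.alloc_mem n _ i).2)
  have hpayd : ∀ i (m : valueSpace D f), Integrable
      (fun v => B.pay n (Function.update v i m) i) (Measure.pi fun _ => valueLaw D f) :=
    fun i m => (integrable_const (2 * |(m : ℝ)|)).mono'
      ((B.measurable_pay n i).comp measurable_update_left).aestronglyMeasurable
      (Filter.Eventually.of_forall fun v => by
        simpa using h.abs_pay_le hD (Function.update v i m) i)
  have hutil : ∀ i (x m : valueSpace D f),
      (OffChainMechanism.trivial (valueSpace D f) n).interimUtility B (valueLaw D f)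
        (fun _ x => x) i x m =
      ∫ v, (x * B.alloc n (Function.update v i m) i - B.pay n (Function.update v i m) i)
        ∂(Measure.pi fun _ => valueLaw D f) := by
    intro i x m
    have := integral_fun_fst (μ := Measure.pi fun _ : Fin n => valueLaw D f)
      (ν := Measure.dirac ()) fun v =>
        x * B.alloc n (Function.update v i m) i - (B.pay n (Function.update v i m) i + 0)
    exact this.trans (by simp only [probReal_univ, one_smul, add_zero])
  have hbest : ∀ i (x m : valueSpace D f) (v : Fin n → valueSpace D f),
      x * B.alloc n (Function.update v i m) i - B.pay n (Function.update v i m) i ≤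
        x * B.alloc n (Function.update v i x) i - B.pay n (Function.update v i x) i := by
    intro i x m v
    have := hsimple n (Function.update v i x) i m
    rwa [Function.update_idem, Function.update_self] at this
  have hint : ∀ i (x m : valueSpace D f), Integrable (fun v =>
      x * B.alloc n (Function.update v i m) i - B.pay n (Function.update v i m) i)
      (Measure.pi fun _ => valueLaw D f) :=
    fun i x m => ((hallocd i m).const_mul _).sub (hpayd i m)
  exact
    { integrable_alloc_deviate := fun i m => (hallocd i m).comp_fst _
      integrable_pay_deviate := fun i m =>
        (((hpayd i m).add (integrable_const 0)).comp_fst (Measure.dirac ()) :)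
      integrable_alloc := fun i => (halloc i).comp_fst _
      integrable_pay := fun i =>
        (((h.integrable_pay hD hmean i).add (integrable_const 0)).comp_fst (Measure.dirac ()) :)
      integrable_burn := (h.integrable_burn hD hmean n).comp_fst _
      best_response := fun i x m => by
        refine (hutil i x m).trans_le
          (le_of_le_of_eq (integral_mono (hint i x m) (hint i x x) fun v => ?_) (hutil i x x).symm)
        exact hbest i x m v
      participation := fun i x => by
        refine le_of_le_of_eq (integral_nonneg fun v => ?_) (hutil i x x).symm
        simpa using h.utility_nonneg (Function.update v i x) i }

/-- The truthful outcome attains the upper bound on revenue, the expected virtual utility. -/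
theorem trivial_expectedRevenue (h : IsProcessOf B U) (n : ℕ) :
    (OffChainMechanism.trivial (valueSpace D f) n).expectedRevenue B (valueLaw D f)
      (fun _ x => x) = ∫ v, U n (vvec D f v) ∂(Measure.pi fun _ => valueLaw D f) := by
  have := isProbabilityMeasure_valueLaw hD
  have h1 := integral_fun_fst (μ := Measure.pi fun _ : Fin n => valueLaw D f)
    (ν := Measure.dirac ()) fun v => ∑ i, (B.pay n v i + 0) - B.burn n v
  simp only [probReal_univ, one_smul, add_zero] at h1
  have h2 : (OffChainMechanism.trivial (valueSpace D f) n).expectedRevenue B (valueLaw D f)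
      (fun _ x => x) = ∫ v, (∑ i, B.pay n v i - B.burn n v)
        ∂(Measure.pi fun _ => valueLaw D f) := by
    rw [← h1]
    refine integral_congr_ae (Filter.Eventually.of_forall fun z => ?_)
    simp [OffChainMechanism.netRevenue, OffChainMechanism.userPay, OffChainMechanism.trivial,
      OnChainAction.userPay, OnChainAction.burn]
  have hU : (fun v => U n (vvec D f v)) = fun v =>
      ∑ i, vv D f (v i) * B.alloc n v i - B.burn n v := by
    ext v
    rw [h.burn_eq]
    simp [vvec]
  rw [h2, hU, integral_sub (integrable_finsetSum _ fun i _ => h.integrable_pay hD hmean i)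
      (h.integrable_burn hD hmean n),
    integral_sub (integrable_finsetSum _ fun i _ => h.integrable_virtual_mul_alloc hD hmean i)
      (h.integrable_burn hD hmean n),
    integral_finsetSum _ fun i _ => h.integrable_pay hD hmean i,
    integral_finsetSum _ fun i _ => h.integrable_virtual_mul_alloc hD hmean i]
  simp_rw [h.integral_pay_eq_virtual hD hmean]

/-! ### Arbitrary off-chain mechanisms -/

/-- No equilibrium of an off-chain mechanism earns the miner more than the expected virtual utility:
payments are bounded by virtual surplus, and virtual surplus net of the burn is bounded pointwise. -/
theorem expectedRevenue_le (h : IsProcessOf B U) {n : ℕ}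
    (M : OffChainMechanism (valueSpace D f) n) (s : ∀ i, valueSpace D f → M.Msg i)
    (hs : M.IsUserBNE B (valueLaw D f) s) :
    M.expectedRevenue B (valueLaw D f) s ≤
      ∫ v, U n (vvec D f v) ∂(Measure.pi fun _ => valueLaw D f) := by
  have := isProbabilityMeasure_valueLaw hD
  set μ := valueLaw D f
  have hL : IsProbabilityMeasure (M.law μ) :=
    inferInstanceAs (IsProbabilityMeasure ((Measure.pi fun _ : Fin n => μ).prod M.seedLaw))
  have hdev : ∀ i y (v : Fin n → valueSpace D f),
      (fun j => s j (Function.update v i y j)) = M.deviate s i (s i y) v := by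
    intro i y v
    ext j
    rcases eq_or_ne j i with rfl | hj
    · simp [OffChainMechanism.deviate]
    · simp [OffChainMechanism.deviate, hj]
  have hmy : ∀ i,
      Integrable (fun z => vv D f (z.1 i) * M.userAlloc B (fun j => s j (z.1 j)) z.2 i)
        (M.law μ) ∧
      ∫ z, M.userPay B (fun j => s j (z.1 j)) z.2 i ∂(M.law μ) ≤
        ∫ z, vv D f (z.1 i) * M.userAlloc B (fun j => s j (z.1 j)) z.2 i ∂(M.law μ) :=
    fun i => integral_pay_le_virtual hD hmean
    (measurePreserving_update_prod μ i M.seedLaw) (c := fun z => z.1 i)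
    ((measurable_pi_apply i).comp measurable_fst) (by simp)
    (A := fun z => M.userAlloc B (fun j => s j (z.1 j)) z.2 i)
    (P := fun z => M.userPay B (fun j => s j (z.1 j)) z.2 i)
    (hs.integrable_alloc i) (hs.integrable_pay i)
    (fun z => (OnChainAction.userAlloc_mem B _ i).1) (fun z => (OnChainAction.userAlloc_mem B _ i).2)
    (by
      intro y
      simp only [hdev]
      exact hs.integrable_alloc_deviate i (s i y))
    (by
      intro x y
      simp only [hdev]
      have := hs.best_response i x (s i y)
      simp only [OffChainMechanism.interimUtility] at this
      rw [integral_sub ((hs.integrable_alloc_deviate i _).const_mul _)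
          (hs.integrable_pay_deviate i _),
        integral_sub ((hs.integrable_alloc_deviate i _).const_mul _)
          (hs.integrable_pay_deviate i _), integral_const_mul, integral_const_mul] at this
      exact this)
    (by
      intro x
      simp only [hdev]
      have := hs.participation i x
      simp only [OffChainMechanism.interimUtility] at this
      rw [integral_sub ((hs.integrable_alloc_deviate i _).const_mul _)
          (hs.integrable_pay_deviate i _), integral_const_mul] at this
      exact this)
  have hUL : ∫ z, U n (vvec D f z.1) ∂(M.law μ) =
      ∫ v, U n (vvec D f v) ∂(Measure.pi fun _ => μ) := by
    rw [OffChainMechanism.law, integral_fun_fst fun v => U n (vvec D f v)]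
    simp
  calc M.expectedRevenue B μ s
      = ∑ i, ∫ z, M.userPay B (fun j => s j (z.1 j)) z.2 i ∂(M.law μ) -
          ∫ z, (M.action (fun j => s j (z.1 j)) z.2).burn B ∂(M.law μ) := by
        simp only [OffChainMechanism.expectedRevenue, OffChainMechanism.netRevenue]
        rw [integral_sub (integrable_finsetSum _ fun i _ => hs.integrable_pay i)
          hs.integrable_burn, integral_finsetSum _ fun i _ => hs.integrable_pay i]
    _ ≤ ∑ i, ∫ z, vv D f (z.1 i) * M.userAlloc B (fun j => s j (z.1 j)) z.2 i ∂(M.law μ) -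
          ∫ z, (M.action (fun j => s j (z.1 j)) z.2).burn B ∂(M.law μ) := by
        exact sub_le_sub_right (Finset.sum_le_sum fun i _ => (hmy i).2) _
    _ = ∫ z, (∑ i, vv D f (z.1 i) * M.userAlloc B (fun j => s j (z.1 j)) z.2 i -
          (M.action (fun j => s j (z.1 j)) z.2).burn B) ∂(M.law μ) := by
        rw [integral_sub (integrable_finsetSum _ fun i _ => (hmy i).1) hs.integrable_burn,
          integral_finsetSum _ fun i _ => (hmy i).1]
    _ ≤ ∫ z, U n (vvec D f z.1) ∂(M.law μ) := by
        refine integral_mono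
          ((integrable_finsetSum _ fun i _ => (hmy i).1).sub hs.integrable_burn)
          ((h.integrable_U hD hmean n).comp_fst _) fun z => ?_
        exact h.virtualSurplus_le hD _ z.1
    _ = _ := hUL

end Integrability

end IsProcessOf

end TFM

theorem mainTheorem2
    (D : Measure ℝ) [IsProbabilityMeasure D] (f : ℝ → ℝ)
    (hD : TFM.IsSmoothRegular D f) (hmean : Integrable (fun v : ℝ => v) D)
    (B : TFM.BlockBuildingProcess (TFM.valueSpace D f))
    -- the virtual-utility functions and their (sub)gradients
    (U : (n : ℕ) → (Fin n → ℝ) → ℝ)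
    (gradU : (n : ℕ) → (Fin n → ℝ) → Fin n → ℝ)
    (hgrad : ∀ (n : ℕ) (v : Fin n → TFM.valueSpace D f),
      TFM.IsSubgradient (U n) (fun j => TFM.vv D f (v j)) (gradU n fun j => TFM.vv D f (v j)))
    (halloc : ∀ (n : ℕ) (v : Fin n → TFM.valueSpace D f) (i : Fin n),
      B.alloc n v i = gradU n (fun j => TFM.vv D f (v j)) i)
    -- values outside the value space (virtual value `-∞`) are not allocated
    (hpay : ∀ (n : ℕ) (v : Fin n → TFM.valueSpace D f) (i : Fin n),
      B.pay n v i = (v i : ℝ) * gradU n (fun j => TFM.vv D f (v j)) i -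
        ∫ y in (0 : ℝ)..(v i : ℝ), (TFM.valueSpace D f).indicator
          (fun y => gradU n (Function.update (fun j => TFM.vv D f (v j)) i (TFM.vv D f y)) i) y)
    (hburn : ∀ (n : ℕ) (v : Fin n → TFM.valueSpace D f),
      B.burn n v = ∑ i, TFM.vv D f (v i) * gradU n (fun j => TFM.vv D f (v j)) i -
        U n (fun j => TFM.vv D f (v j)))
    (hconvex : ∀ n : ℕ, ConvexOn ℝ univ (U n)) (hmono : ∀ n : ℕ, Monotone (U n))
    (hneg : ∀ (n : ℕ) (v : Fin n → TFM.valueSpace D f) (i : Fin n),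
      TFM.vv D f (v i) < 0 → gradU n (fun j => TFM.vv D f (v j)) i = 0)
    (hadd : ∀ (n t : ℕ) (v : Fin n → TFM.valueSpace D f) (w : Fin t → TFM.valueSpace D f),
      (∀ j, TFM.vv D f (w j) ≤ 0) →
      U n (fun j => TFM.vv D f (v j)) =
        U (n + t) (Fin.append (fun j => TFM.vv D f (v j)) (fun j => TFM.vv D f (w j)))) :
    TFM.OnChainUserSimple B ∧ TFM.OffChainInfluenceProof B (TFM.valueLaw D f) := by
  have hA : ∀ n (v : Fin n → TFM.valueSpace D f), B.alloc n v = gradU n (TFM.vvec D f v) :=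
    fun n v => funext (halloc n v)
  have hneg' : ∀ n (v : Fin n → TFM.valueSpace D f) i, TFM.vv D f (v i) < 0 →
      B.alloc n v i = 0 := fun n v i hi => (halloc n v i).trans (hneg n v i hi)
  have hvec : ∀ n (v : Fin n → TFM.valueSpace D f) i (y : TFM.valueSpace D f),
      Function.update (TFM.vvec D f v) i (TFM.vv D f y) =
        TFM.vvec D f (Function.update v i y) := by
    intro n v i y
    ext j
    rcases eq_or_ne j i with rfl | hj
    · simp [TFM.vvec]
    · simp [TFM.vvec, hj]
  have h : TFM.IsProcessOf B U :=
    { subgradient := fun n v => by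
        rw [hA]
        exact hgrad n v
      alloc_congr := fun n v w hvw => by rw [hA, hA, hvw]
      pay_eq := fun n v i => by
        rw [hpay, halloc, TFM.intervalIntegral_indicator_eq_rent (TFM.measurableSet_valueSpace hD)
          (TFM.IsProcessOf.measurable_alloc_update B n v i) (fun y => (B.alloc_mem _ _ _).1)]
        · exact fun y hy => hneg' n _ i (by simpa using (TFM.vv_le hD y.2).trans_lt hy)
        · intro y
          rw [hA, ← hvec]
          rfl
      burn_eq := fun n v => by
        rw [hburn, hA]
        rfl
      mono := hmono
      neg := hneg'
      add := fun n t v w hw => by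
        refine (hadd n t v w hw).trans (congrArg _ ?_)
        ext k
        refine Fin.addCases (fun j => ?_) (fun j => ?_) k <;> simp [TFM.vvec] }
  have hsimple : TFM.OnChainUserSimple B :=
    h.onChainUserSimple hD
  refine ⟨hsimple, fun n => ⟨h.trivial_isUserBNE hD hmean hsimple n, fun M s hs => ?_⟩⟩
  rw [h.trivial_expectedRevenue hD hmean]
  exact h.expectedRevenue_le hD hmean M s hs
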